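/- Let $\eta(\tau)=q^{1/24}\prod_{n\ge1}(1-q^n)$, $q=e^{2\pi i\tau}$, $\operatorname{Im}\tau>0$, be the Dedekind eta function (also written $\eta(q)$; $q^s$ means $e^{2\pi i s\tau}$), and write $\eta(q)^{-24}=\sum_{n\in\mathbb Z}a(n)q^n$. Let $p$ be a prime and $\zeta_p=e^{2\pi i/p}$. For a smooth projective K3 surface $S$ over an algebraically closed field, with Picard number $\rho(S)$, the twisted $SU(p)/\mathbb Z_p$ Vafa–Witten partition function and its coefficients $\alpha_{3,p}(n)$ are given by $$Z_{tw}(q)=\sum_{n\in\mathbb Z}\alpha_{3,p}(n)q^{n/p}=\frac{q^p}{p^2}\,\eta(q^p)^{-24}+q^p\Big(p^{21}\eta(q^{1/p})^{-24}+p^{\rho(S)-1}\sum_{j=1}^{p-1}\eta(\zeta_p^jq^{1/p})^{-24}\Big).$$ Put $\alpha'_{3,p}(n)=\alpha_{3,p}(pn)$ and let $I_{13}$ be the modified Bessel function of the first kind. If $S$ is supersingular, that is $\rho(S)=22$, then $\alpha_{3,p}(n)=0$ whenever $p\nmid n$, and $$Z_{tw}(q)=\sum_{n\ge0}\alpha'_{3,p}(n)q^n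 .$$ For all $n\in\mathbb Z$, $$\alpha'_{3,p}(n)=p^{22}a\big(p(n-p)\big)+\begin{cases}\frac1{p^2}\,a\big(\frac np-1\big)&\text{if }p\mid n,\\0&\text{otherwise.}\end{cases}$$ As $n\to\infty$, $$\alpha'_{3,p}(n)=\frac{2\pi p^{31/2}}{(n-p)^{13/2}}\,I_{13}\big(4\pi\sqrt{p(n-p)}\big)\Big(1+O_p\big(e^{-2\pi\sqrt{pn}}\big)\Big),$$ where the implied constant depends only on $p$, and $$\alpha'_{3,p}(n)\sim\frac{2\pi p^{31/2}}{n^{13/2}}\,I_{13}\big(4\pi\sqrt{pn}\big)\sim\frac{p^{61/4}\,e^{4\pi\sqrt{pn}}}{\sqrt2\,n^{27/4}} .$$ -/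

import Mathlib

open Filter Topology Asymptotics

universe u

/-! ### K3 surfaces and their Picard number -/

namespace K3

open CategoryTheory AlgebraicGeometry Limits

attribute [local instance] MvPolynomial.gradedAlgebra

/-- A `k`-scheme `f : X ⟶ Spec k` is projective if it admits a closed immersion of `k`-schemes into
some projective space `Proj k[x₀, …, x_N]`. -/
def IsProjectiveOver {k : Type u} [Field k] {X : Scheme.{u}}
    (f : X ⟶ Spec (CommRingCat.of k)) : Prop :=
  ∃ (N : ℕ) (i : X ⟶ Proj (MvPolynomial.homogeneousSubmodule (Fin (N + 1)) k)),
    IsClosedImmersion i ∧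
      i ≫ Proj.toSpecZero (MvPolynomial.homogeneousSubmodule (Fin (N + 1)) k) ≫
        Spec.map (CommRingCat.ofHom
          (algebraMap k (MvPolynomial.homogeneousSubmodule (Fin (N + 1)) k 0))) = f

/-- The functor sending a commutative ring to its multiplicative monoid. -/
def multiplicativeMonoid : CommRingCat.{u} ⥤ CommMonCat.{u} where
  obj R := CommMonCat.of R
  map φ := CommMonCat.ofHom φ.hom.toMonoidHom

instance : PreservesLimits multiplicativeMonoid.{u} :=
  have : PreservesLimits (multiplicativeMonoid.{u} ⋙ forget CommMonCat.{u}) :=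
    inferInstanceAs (PreservesLimits (forget CommRingCat.{u}))
  have : ReflectsLimits (forget CommMonCat.{u}) := reflectsLimits_of_reflectsIsomorphisms
  preservesLimits_of_reflects_of_preserves multiplicativeMonoid (forget CommMonCat.{u})

/-- The functor sending a commutative ring to its group of units, written additively. -/
def unitsFunctor : CommRingCat.{u} ⥤ AddCommGrpCat.{u} :=
  multiplicativeMonoid ⋙ CommMonCat.units ⋙ CommGrpCat.toAddCommGrp

instance : PreservesLimits unitsFunctor.{u} :=
  have : CommGrpCat.toAddCommGrp.{u}.IsEquivalence :=
    inferInstanceAs commGroupAddCommGroupEquivalence.{u}.functor.IsEquivalence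
  inferInstanceAs (PreservesLimits
    (multiplicativeMonoid ⋙ CommMonCat.units ⋙ CommGrpCat.toAddCommGrp))

/-- The structure sheaf `𝒪_X`, as a sheaf of abelian groups. -/
def additiveSheaf (X : Scheme.{u}) :
    Sheaf (Opens.grothendieckTopology X) AddCommGrpCat.{u} :=
  (sheafCompose (Opens.grothendieckTopology X)
    (forget₂ CommRingCat.{u} RingCat.{u} ⋙ forget₂ RingCat.{u} AddCommGrpCat.{u})).obj X.sheaf

/-- The sheaf of units `𝒪_X^×`, as a sheaf of abelian groups. -/
def unitsSheaf (X : Scheme.{u}) :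
    Sheaf (Opens.grothendieckTopology X) AddCommGrpCat.{u} :=
  (sheafCompose (Opens.grothendieckTopology X) unitsFunctor.{u}).obj X.sheaf

noncomputable section

instance (X : Scheme.{u}) :
    HasExt.{u} (Sheaf (Opens.grothendieckTopology X) AddCommGrpCat.{u}) :=
  hasExt_of_enoughInjectives _

/-- The Picard group `Pic X = H¹(X, 𝒪_X^×)`. -/
abbrev Pic (X : Scheme.{u}) : Type u := Sheaf.H (unitsSheaf X) 1

/-- The Picard number of a K3 surface `X` over an algebraically closed field: the rank of its
Néron–Severi group, which for a K3 surface is the whole of `Pic X`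
(a finitely generated free abelian group). -/
def picardNumber (X : Scheme.{u}) : ℕ := Module.finrank ℤ (Pic X)

/-- The inclusion of the base field into the function field of an integral `k`-scheme. -/
def toFunctionField {k : Type u} [Field k] {X : Scheme.{u}} [IsIntegral X]
    (f : X ⟶ Spec (CommRingCat.of k)) : k →+* X.functionField :=
  ((Scheme.ΓSpecIso (CommRingCat.of k)).inv ≫ f.appTop ≫
    X.presheaf.germ ⊤ (genericPoint X) trivial).hom

/-- The local ring of an integral scheme at `x`, as a subring of the function field. -/
def localRing (X : Scheme.{u}) [IsIntegral X] (x : X) : Subring X.functionField :=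
  (algebraMap (X.presheaf.stalk x) X.functionField).range

/-- The canonical bundle `ω = ⋀² Ω_{X/k}` of a smooth integral surface `X` over `k` is trivial:
there is a rational 2-form `ω₀ ∈ ⋀² Ω_{K(X)/k}` which at every point `x` generates the stalk
of the canonical bundle, i.e. the `𝒪_{X,x}`-submodule of `⋀² Ω_{K(X)/k}` spanned by the
forms `da ∧ db` with `a, b ∈ 𝒪_{X,x}`. (The canonical bundle is a line bundle, so it embeds into
its generic stalk, and an isomorphism `𝒪_X ≅ ω` is the same as such a form `ω₀`.) -/
def HasTrivialCanonicalBundle {k : Type u} [Field k] {X : Scheme.{u}} [IsIntegral X]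
    (f : X ⟶ Spec (CommRingCat.of k)) : Prop :=
  letI : Algebra k X.functionField := (toFunctionField f).toAlgebra
  ∃ ω₀ : ⋀[X.functionField]^2 (Ω[X.functionField⁄k]), ∀ x : X,
    Submodule.span (localRing X x)
      {ω : ⋀[X.functionField]^2 (Ω[X.functionField⁄k]) |
        ∃ a ∈ localRing X x, ∃ b ∈ localRing X x,
          ω = exteriorPower.ιMulti X.functionField 2
            ![KaehlerDifferential.D k X.functionField a,
              KaehlerDifferential.D k X.functionField b]}
      = Submodule.span (localRing X x) {ω₀}

/-- A smooth projective K3 surface over `k`: an integral smooth projective `k`-scheme of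
dimension two with trivial canonical bundle and `H¹(X, 𝒪_X) = 0`. -/
structure IsK3Surface {k : Type u} [Field k] {X : Scheme.{u}}
    (f : X ⟶ Spec (CommRingCat.of k)) : Prop where
  isIntegral : IsIntegral X
  projective : IsProjectiveOver f
  smooth : SmoothOfRelativeDimension 2 f
  trivialCanonical : HasTrivialCanonicalBundle f
  h1_eq_zero : Subsingleton (Sheaf.H (additiveSheaf X) 1)

end

end K3

/-! ### The twisted partition function -/

namespace VafaWitten

open AlgebraicGeometry

noncomputable section

/-- The `n`-th coefficient of the expansion `∑ c(n) e^{2πi n τ / h}` of an `h`-periodic function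
on the upper half-plane, computed along the horizontal segment from `i` to `h + i`. -/
def fourierCoefficient (h : ℝ) (F : ℂ → ℂ) (n : ℤ) : ℂ :=
  (1 / h : ℂ) * ∫ x in (0 : ℝ)..h,
    F (x + Complex.I) * Complex.exp (-(2 * Real.pi * Complex.I * n * (x + Complex.I) / h))

/-- `η^{-24}` as a function of `τ`, where `q = e^{2πiτ}`. -/
def etaInv24 (τ : ℂ) : ℂ := (ModularForm.eta τ ^ 24)⁻¹

/-- The coefficients of `η(q)^{-24} = ∑ a(n) qⁿ`. -/
def etaCoeff (n : ℤ) : ℂ := fourierCoefficient 1 etaInv24 n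

/-- The twisted `SU(p)/ℤ_p` Vafa–Witten partition function of a K3 surface `S`, as a function of
`τ`, where `q^s = e^{2πi s τ}`. The value of `η` at the nome `ζ_p^j q^{1/p} = e^{2πi (τ + j)/p}` is
its value at the point `(τ + j)/p` of the upper half-plane, and at `q^p` its value at `p τ`. -/
def twistedPartitionFunction (S : Scheme.{u}) (p : ℕ) (τ : ℂ) : ℂ :=
  Complex.exp (2 * Real.pi * Complex.I * p * τ) / (p : ℂ) ^ 2 * etaInv24 (p * τ) +
    Complex.exp (2 * Real.pi * Complex.I * p * τ) *
      ((p : ℂ) ^ 21 * etaInv24 (τ / p) +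
        (p : ℂ) ^ ((K3.picardNumber S : ℤ) - 1) *
          ∑ j ∈ Finset.Icc 1 (p - 1), etaInv24 ((τ + j) / p))

/-- The twisted Vafa–Witten invariants: the coefficients `α_{3,p}(n)` in
`Z_tw(q) = ∑ α_{3,p}(n) q^{n/p}`. -/
def alpha3 (S : Scheme.{u}) (p : ℕ) (n : ℤ) : ℂ :=
  fourierCoefficient p (twistedPartitionFunction S p) n

/-- `α'_{3,p}(n) = α_{3,p}(pn)`. -/
def alpha3' (S : Scheme.{u}) (p : ℕ) (n : ℤ) : ℂ := alpha3 S p (p * n)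

/-- The modified Bessel function `I_ν` of the first kind, of integral order `ν ≥ 0`. -/
def besselI (ν : ℕ) (x : ℝ) : ℝ :=
  ∑' m : ℕ, (x / 2) ^ (2 * m + ν) / (m.factorial * (m + ν).factorial)

end

end VafaWitten

open K3 VafaWitten

namespace VafaWitten

open Complex (I)
open scoped Real

/-! ### Extraction of Fourier coefficients -/

/-! Exact part. When ρ(S) = 22 the weight p^(ρ-1) is p^21, so the term η(q^(1/p))⁻²⁴ becomes the j =
0 member of a full sum over the p-th roots of unity. That sum kills every power q^(k/p) with p ∤ k
and multiplies the others by p; after the factor q^p, the surviving k is p(n - p). Hence the term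
p^22 a(p(n - p)) and the absence of fractional powers (`hasSum_sum_etaInv24_div`,
`hasSum_twistedPartitionFunction`). Integrating the absolutely convergent series termwise identifies
its coefficients with the Fourier integrals that define `alpha3` and `etaCoeff`.

Asymptotic part. The main task is a(m) = M(m)(1 + O(e^(-2π√m))), where M(m) = 2π m^(-13/2)
I₁₃(4π√m). Instead of a full circle method, η⁻²⁴ is compared with the explicit series Σ M(m) q^m.
Expanding M(m) in powers of m and applying the Lipschitz formula to each Σ m^l q^m shows that this
series equals τ^12 e^(2πi/τ) + O(1) in the strip |Re τ| ≤ 1/2 (`exists_norm_mainSeries_sub_le`).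
This is also the behaviour of η⁻²⁴ near the cusp 0, by weight -12 modularity.

Away from 0, reduction to the fundamental domain shows that the next largest contribution comes from
±1/2: a peak of height about y^12 e^(π/(2y)) with a Gaussian profile of width y^(3/2)
(`exists_norm_etaInv24_sub_pow_mul_exp_le`). Integrating the difference at height y = 1/(2√m) gives
an error O(e^(2π√m) m^(-27/4)) (`exists_norm_etaCoeff_sub_mainCoeff_le`). The Gaussian width
supplies the last factor m^(-3/4), so the power of m matches that of the main term and the relative
error is a pure exponential.

Laplace's method for the Bessel integral (`tendsto_besselI`) gives the size of M(m). The remaining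
term a(n/p - 1)/p² has exponent 4π√(n/p - 1), about 1/p times that of the main term; p ≥ 2 makes it
fit inside the same error (`expMain_one_le`). -/

lemma norm_exp_two_pi_I (n : ℤ) (h x y : ℝ) :
    ‖Complex.exp (2 * π * I * n * (x + y * I) / h)‖ = Real.exp (-(2 * π * n * y / h)) := by
  rw [Complex.norm_exp]
  congr 1
  rw [Complex.div_ofReal_re, show (2 * (π : ℂ) * I * n * (x + y * I)) =
    ((-(2 * π * n * y) : ℝ) : ℂ) + ((2 * π * n * x : ℝ) : ℂ) * I by
      push_cast
      linear_combination (2 * π * n * y : ℂ) * Complex.I_mul_I]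
  simp only [Complex.add_re, Complex.ofReal_re, Complex.re_ofReal_mul, Complex.I_re]
  ring

lemma integral_exp_two_pi_I {h : ℝ} (hh : 0 < h) (t : ℝ) (n : ℤ) :
    ∫ x in t..t + h, Complex.exp (2 * π * I * n * x / h) = if n = 0 then (h : ℂ) else 0 := by
  split_ifs with hn
  · simp [hn]
  · have hc : (2 * π * I * n / h : ℂ) ≠ 0 := by
      simp [hn, hh.ne', Real.pi_ne_zero]
    have := integral_exp_mul_complex (a := t) (b := t + h) hc
    have e : ∀ x : ℂ, (2 * π * I * n / h : ℂ) * x = 2 * π * I * n * x / h := fun x => by ring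
    simp only [e] at this
    rw [this]
    have h2 : (2 * π * I * n * ((t + h : ℝ) : ℂ) / h : ℂ) =
        2 * π * I * n * t / h + n * (2 * π * I) := by
      have : (h : ℂ) ≠ 0 := by exact_mod_cast hh.ne'
      push_cast
      field_simp
    rw [h2, Complex.exp_add, Complex.exp_int_mul_two_pi_mul_I]
    simp

/-- Termwise integration of an absolutely convergent Fourier series against a character. -/
lemma hasSum_integral_mul_exp {ι : Type*} [Countable ι] {h y : ℝ} (hh : 0 < h) (t : ℝ)
    {c : ι → ℂ} {k : ι → ℤ} {F : ℝ → ℂ}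
    (hF : ∀ x : ℝ, HasSum (fun i => c i * Complex.exp (2 * π * I * k i * (x + y * I) / h)) (F x))
    (n : ℤ) :
    HasSum (fun i => if k i = n then h * c i else 0)
      (∫ x in t..t + h, F x * Complex.exp (-(2 * π * I * n * (x + y * I) / h))) := by
  -- The norms of the terms do not depend on x, so summability at x = 0 gives one dominating series
  -- for the whole segment.
  have hs : Summable fun i => ‖c i‖ * Real.exp (-(2 * π * k i * y / h)) := by
    have := (hF 0).summable.norm
    simpa only [norm_mul, norm_exp_two_pi_I] using this
  have hneg (x : ℝ) : Complex.exp (-(2 * π * I * n * (x + y * I) / h)) =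
      Complex.exp (2 * π * I * ((-n : ℤ) : ℂ) * (x + y * I) / h) := by
    congr 1
    push_cast
    ring
  have key := intervalIntegral.hasSum_integral_of_dominated_convergence (a := t) (b := t + h)
    (μ := MeasureTheory.volume)
    (F := fun i (x : ℝ) => c i * Complex.exp (2 * π * I * k i * (x + y * I) / h) *
      Complex.exp (-(2 * π * I * n * (x + y * I) / h)))
    (f := fun x : ℝ => F x * Complex.exp (-(2 * π * I * n * (x + y * I) / h)))
    (fun i _ => ‖c i‖ * Real.exp (-(2 * π * k i * y / h)) *
      Real.exp (-(2 * π * (-n : ℤ) * y / h)))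
    (fun i => by
      apply Continuous.aestronglyMeasurable
      fun_prop)
    (fun i => Eventually.of_forall fun x _ => by
      rw [hneg, norm_mul, norm_mul, norm_exp_two_pi_I, norm_exp_two_pi_I])
    (Eventually.of_forall fun x _ => hs.mul_right _)
    (by simp)
    (Eventually.of_forall fun x _ => (hF x).mul_right _)
  refine HasSum.congr_fun key fun i => ?_
  have e (x : ℝ) : c i * Complex.exp (2 * π * I * k i * (x + y * I) / h) *
      Complex.exp (-(2 * π * I * n * (x + y * I) / h)) =
      c i * Complex.exp (2 * π * I * (k i - n) * (y * I) / h) *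
        Complex.exp (2 * π * I * ((k i - n : ℤ) : ℂ) * x / h) := by
    rw [mul_assoc (c i), mul_assoc (c i), ← Complex.exp_add, ← Complex.exp_add]
    congr 2
    push_cast
    ring
  simp only [e]
  rw [intervalIntegral.integral_const_mul, integral_exp_two_pi_I hh]
  simp only [sub_eq_zero]
  split_ifs with hk
  · rw [hk]
    simp
    ring
  · simp

lemma integral_mul_exp_of_hasSum {h y : ℝ} (hh : 0 < h) (t : ℝ) {c : ℤ → ℂ} {F : ℝ → ℂ}
    (hF : ∀ x : ℝ, HasSum (fun i : ℤ => c i * Complex.exp (2 * π * I * i * (x + y * I) / h)) (F x))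
    (n : ℤ) :
    ∫ x in t..t + h, F x * Complex.exp (-(2 * π * I * n * (x + y * I) / h)) = h * c n := by
  have h1 := hasSum_integral_mul_exp hh t (k := id) hF n
  have h2 := hasSum_ite_eq n (h * c n : ℂ)
  refine h1.unique (h2.congr_fun ?_)
  intro i
  simp only [id]
  split_ifs with hi
  · rw [hi]
  · rfl

lemma fourierCoefficient_eq_of_hasSum {h : ℝ} (hh : 0 < h) {c : ℤ → ℂ} {F : ℂ → ℂ}
    (hF : ∀ x : ℝ, HasSum (fun i : ℤ => c i * Complex.exp (2 * π * I * i * (x + I) / h))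
      (F (x + I))) (n : ℤ) :
    fourierCoefficient h F n = c n := by
  have := integral_mul_exp_of_hasSum (y := 1) hh 0 (F := fun x => F (x + I)) (c := c)
    (by simpa using hF) n
  simp only [Complex.ofReal_one, one_mul, zero_add] at this
  rw [fourierCoefficient, this]
  have : (h : ℂ) ≠ 0 := by exact_mod_cast hh.ne'
  field_simp

/-! ### The expansion of `η⁻²⁴` -/

/-- The function `q ↦ ∏ (1 - qⁿ)⁻²⁴` on the unit disc. -/
noncomputable def eulerInv24 (q : ℂ) : ℂ := ((∏' n : ℕ, (1 - q ^ (n + 1))) ^ 24)⁻¹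

lemma tprod_one_sub_pow_ne_zero {q : ℂ} (hq : ‖q‖ < 1) : ∏' n : ℕ, (1 - q ^ (n + 1)) ≠ 0 := by
  simp only [sub_eq_add_neg]
  refine tprod_one_add_ne_zero_of_summable (f := fun n => -q ^ (n + 1)) (fun n h => ?_) ?_
  · have h1 : q ^ (n + 1) = 1 := by linear_combination -h
    have h2 := congrArg norm h1
    rw [norm_pow, norm_one] at h2
    exact (pow_lt_one₀ (norm_nonneg _) hq n.succ_ne_zero).ne h2
  · simpa using (summable_nat_add_iff 1).mpr (summable_geometric_of_lt_one (norm_nonneg _) hq)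

lemma differentiableOn_eulerInv24 : DifferentiableOn ℂ eulerInv24 (Metric.ball 0 1) := by
  refine (ModularForm.differentiableOn_tprod_one_sub_pow.fun_pow 24).inv fun q hq => ?_
  exact pow_ne_zero _ (tprod_one_sub_pow_ne_zero (by simpa using hq))

lemma eulerInv24_zero : eulerInv24 0 = 1 := by
  simp [eulerInv24]

/-- The Taylor coefficients of `∏ (1 - qⁿ)⁻²⁴`. -/
noncomputable def eulerCoeff (n : ℕ) : ℂ := (n.factorial : ℂ)⁻¹ * iteratedDeriv n eulerInv24 0

lemma eulerCoeff_zero : eulerCoeff 0 = 1 := by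
  simp [eulerCoeff, eulerInv24_zero]

lemma hasSum_eulerInv24 {q : ℂ} (hq : ‖q‖ < 1) :
    HasSum (fun n : ℕ => eulerCoeff n * q ^ n) (eulerInv24 q) := by
  have := Complex.hasSum_taylorSeries_on_ball differentiableOn_eulerInv24
    (z := q) (by simpa using hq)
  refine this.congr_fun fun n => ?_
  simp only [sub_zero, smul_eq_mul, eulerCoeff]
  ring

lemma etaInv24_eq (τ : ℂ) :
    etaInv24 τ = Complex.exp (-(2 * π * I * τ)) * eulerInv24 (Complex.exp (2 * π * I * τ)) := by
  have h : (Function.Periodic.qParam 24 τ ^ 24)⁻¹ = Complex.exp (-(2 * π * I * τ)) := by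
    rw [Function.Periodic.qParam, ← Complex.exp_nat_mul, ← Complex.exp_neg]
    congr 1
    push_cast
    ring
  rw [etaInv24, eulerInv24, ModularForm.eta, mul_pow, mul_inv, h]
  simp only [ModularForm.eta_q_eq_pow]

lemma norm_exp_two_pi_I_lt_one {τ : ℂ} (hτ : 0 < τ.im) : ‖Complex.exp (2 * π * I * τ)‖ < 1 :=
  UpperHalfPlane.norm_exp_two_pi_I_lt_one ⟨τ, hτ⟩

/-- The coefficients of `η⁻²⁴`, indexed by the exponent. -/
noncomputable def etaTaylorCoeff (n : ℤ) : ℂ := if -1 ≤ n then eulerCoeff (n + 1).toNat else 0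

lemma hasSum_etaTaylorCoeff {τ : ℂ} (hτ : 0 < τ.im) :
    HasSum (fun n : ℤ => etaTaylorCoeff n * Complex.exp (2 * π * I * n * τ)) (etaInv24 τ) := by
  have h := (hasSum_eulerInv24 (norm_exp_two_pi_I_lt_one hτ)).mul_left
    (Complex.exp (-(2 * π * I * τ)))
  rw [← etaInv24_eq] at h
  have hinj : Function.Injective fun n : ℕ => (n : ℤ) - 1 := fun a b hab => by
    simpa using hab
  rw [← hinj.hasSum_iff]
  · refine h.congr_fun fun n => ?_
    simp only [Function.comp, etaTaylorCoeff]
    rw [if_pos (by omega), sub_add_cancel, Int.toNat_natCast, mul_left_comm, ← Complex.exp_nat_mul,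
      ← Complex.exp_add]
    congr 2
    push_cast
    ring
  · intro n hn
    rw [etaTaylorCoeff, if_neg, zero_mul]
    intro h
    exact hn ⟨(n + 1).toNat, by simp; omega⟩

lemma etaCoeff_eq (n : ℤ) : etaCoeff n = etaTaylorCoeff n := by
  have := fourierCoefficient_eq_of_hasSum (h := 1) one_pos (c := etaTaylorCoeff) (F := etaInv24)
    (fun x => by
      simpa using hasSum_etaTaylorCoeff (τ := x + I) (by simp)) n
  exact this

lemma hasSum_etaInv24 {τ : ℂ} (hτ : 0 < τ.im) :
    HasSum (fun n : ℤ => etaCoeff n * Complex.exp (2 * π * I * n * τ)) (etaInv24 τ) := by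
  simpa only [etaCoeff_eq] using hasSum_etaTaylorCoeff hτ

lemma etaCoeff_eq_zero {n : ℤ} (hn : n < -1) : etaCoeff n = 0 := by
  rw [etaCoeff_eq, etaTaylorCoeff, if_neg (by omega)]

lemma etaCoeff_neg_one : etaCoeff (-1) = 1 := by
  rw [etaCoeff_eq, etaTaylorCoeff, if_pos le_rfl]
  simpa using eulerCoeff_zero

lemma etaInv24_neg_conj {τ : ℂ} (hτ : 0 < τ.im) :
    etaInv24 (-(starRingEnd ℂ τ)) = starRingEnd ℂ (etaInv24 τ) := by
  rw [etaInv24_eq, etaInv24_eq, map_mul, ← Complex.exp_conj]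
  have e : Complex.exp (2 * π * I * -(starRingEnd ℂ τ)) =
      starRingEnd ℂ (Complex.exp (2 * π * I * τ)) := by
    rw [← Complex.exp_conj]
    congr 1
    simp [map_ofNat]
  rw [e, eulerInv24, eulerInv24, map_inv₀, map_pow,
    (ModularForm.multipliable_one_sub_pow (norm_exp_two_pi_I_lt_one hτ)).map_tprod
      (starRingEnd ℂ) Complex.continuous_conj]
  simp [map_ofNat]

/-- Conjugating the expansion at -τ̄ gives another expansion of η⁻²⁴ at τ, so uniqueness of
coefficients applies. Reality is what allows the relative error E in the theorem to be a real
number. -/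
lemma etaCoeff_conj (n : ℤ) : starRingEnd ℂ (etaCoeff n) = etaCoeff n := by
  have h := fourierCoefficient_eq_of_hasSum (h := 1) one_pos
    (c := fun n => starRingEnd ℂ (etaCoeff n)) (F := etaInv24) (fun x => by
      have h1 := (hasSum_etaInv24 (τ := -x + I) (by simp)).map (starRingEnd ℂ)
        Complex.continuous_conj
      rw [← etaInv24_neg_conj (by simp)] at h1
      have e : -(starRingEnd ℂ) (-(x : ℂ) + I) = x + I := by simp [add_comm]
      rw [e] at h1
      refine h1.congr_fun fun n => ?_
      simp only [Function.comp, map_mul, ← Complex.exp_conj]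
      congr 2
      simp only [map_add, map_neg, Complex.conj_ofReal, Complex.conj_I, map_intCast,
        map_ofNat, Complex.ofReal_one]
      ring) n
  exact h.symm

lemma etaCoeff_eq_re (n : ℤ) : etaCoeff n = ((etaCoeff n).re : ℂ) :=
  (Complex.conj_eq_iff_re.mp (etaCoeff_conj n)).symm

/-! ### Growth near the cusp -/

/-- Once the polar term q⁻¹ is removed only exponents n ≥ 0 remain, and their terms are largest in
norm on the line Im τ = 1/2. The absolutely convergent series at i/2 therefore dominates. -/
lemma exists_norm_etaInv24_sub_exp_le :
    ∃ C : ℝ, 0 < C ∧ ∀ τ : ℂ, 1 / 2 ≤ τ.im →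
      ‖etaInv24 τ - Complex.exp (-(2 * π * I * τ))‖ ≤ C := by
  have h0 := hasSum_etaInv24 (τ := I / 2) (by simp)
  have hs := h0.summable.norm
  refine ⟨∑' n : ℤ, ‖etaCoeff n * Complex.exp (2 * π * I * n * (I / 2))‖ + 1,
    by positivity, fun τ hτ => ?_⟩
  have h1 := (hasSum_etaInv24 (τ := τ) (by linarith)).sub
    (hasSum_ite_eq (-1 : ℤ) (Complex.exp (-(2 * π * I * τ))))
  rw [← h1.tsum_eq]
  refine (tsum_of_norm_bounded hs.hasSum fun n => ?_).trans (by linarith)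
  rcases lt_trichotomy n (-1) with h | rfl | h
  · simp [etaCoeff_eq_zero h, h.ne]
  · simp [etaCoeff_neg_one]
  · rw [if_neg h.ne', sub_zero, norm_mul, norm_mul]
    refine mul_le_mul_of_nonneg_left ?_ (norm_nonneg _)
    have hn : (0 : ℝ) ≤ n := by exact_mod_cast (by omega : 0 ≤ n)
    have e (z : ℂ) : ‖Complex.exp (2 * π * I * n * z)‖ = Real.exp (-(2 * π * n * z.im)) := by
      have := norm_exp_two_pi_I n 1 z.re z.im
      simpa using this
    rw [e, e]
    apply Real.exp_le_exp.mpr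
    have : (I / 2 : ℂ).im = 1 / 2 := by simp
    rw [this]
    have : 2 * π * n * (1 / 2) ≤ 2 * π * n * τ.im := by gcongr
    linarith

lemma exists_norm_etaInv24_le :
    ∃ C : ℝ, 0 < C ∧ ∀ τ : ℂ, 1 / 2 ≤ τ.im → ‖etaInv24 τ‖ ≤ C * Real.exp (2 * π * τ.im) := by
  obtain ⟨C, hC, h⟩ := exists_norm_etaInv24_sub_exp_le
  refine ⟨C + 1, by positivity, fun τ hτ => ?_⟩
  have e : ‖Complex.exp (-(2 * π * I * τ))‖ = Real.exp (2 * π * τ.im) := by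
    have := norm_exp_two_pi_I (-1) 1 τ.re τ.im
    simpa using this
  have h1 : (1 : ℝ) ≤ Real.exp (2 * π * τ.im) := Real.one_le_exp (by positivity)
  calc ‖etaInv24 τ‖ = ‖(etaInv24 τ - Complex.exp (-(2 * π * I * τ))) +
        Complex.exp (-(2 * π * I * τ))‖ := by rw [sub_add_cancel]
    _ ≤ C + Real.exp (2 * π * τ.im) := (norm_add_le _ _).trans (add_le_add (h τ hτ) e.le)
    _ ≤ _ := by nlinarith

/-! ### Modularity -/

-- η²⁴ is the discriminant, a form of weight 12 for SL₂(ℤ), so its inverse has weight -12.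
open UpperHalfPlane in
lemma etaInv24_eq_denom_pow_mul (g : Matrix.SpecialLinearGroup (Fin 2) ℤ) (z : ℍ) :
    etaInv24 z = ((g 1 0 : ℂ) * z + g 1 1) ^ 12 * etaInv24 (g • z : ℍ) := by
  have h := SlashInvariantForm.slash_action_eqn' (k := 12) CuspForm.discriminant
    (γ := (g : GL (Fin 2) ℝ)) (by exact ⟨g, rfl⟩) z
  have hd : ((g 1 0 : ℂ) * z + g 1 1) ≠ 0 := by
    have := UpperHalfPlane.denom_ne_zero g z
    simpa [UpperHalfPlane.denom] using this
  have h2 : ModularForm.eta (g • z : ℍ) ^ 24 =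
      ((g 1 0 : ℂ) * z + g 1 1) ^ 12 * ModularForm.eta z ^ 24 := by
    have h3 := h
    simp only [CuspForm.coe_discriminant, ModularForm.discriminant] at h3
    simpa using h3
  rw [etaInv24, etaInv24, h2, mul_inv, mul_inv_cancel_left₀ (pow_ne_zero _ hd)]

/-! ### The expansion of the twisted partition function -/

lemma sum_exp_two_pi_I_mul_div {p : ℕ} (hp : 0 < p) (k : ℤ) :
    ∑ j ∈ Finset.range p, Complex.exp (2 * π * I * k * j / p) = if (p : ℤ) ∣ k then (p : ℂ) else 0 := by
  have hp0 : (p : ℂ) ≠ 0 := by exact_mod_cast hp.ne'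
  have e (j : ℕ) : Complex.exp (2 * π * I * k * j / p) = Complex.exp (2 * π * I * k / p) ^ j := by
    rw [← Complex.exp_nat_mul]
    congr 1
    ring
  simp only [e]
  split_ifs with h
  · obtain ⟨m, rfl⟩ := h
    have : Complex.exp (2 * π * I * ((p * m : ℤ) : ℂ) / p) = 1 := by
      rw [Complex.exp_eq_one_iff]
      refine ⟨m, ?_⟩
      push_cast
      field_simp
    simp only [this]
    simp
  · have h1 : Complex.exp (2 * π * I * k / p) ≠ 1 := by
      rw [Ne, Complex.exp_eq_one_iff]
      rintro ⟨m, hm⟩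
      apply h
      refine ⟨m, ?_⟩
      have h2 : (2 * π * I) * (k : ℂ) = (2 * π * I) * (p * m) := by
        field_simp at hm
        linear_combination (2 * π * I : ℂ) * hm
      have h3 := mul_left_cancel₀ Complex.two_pi_I_ne_zero h2
      exact_mod_cast h3
    have h2 : Complex.exp (2 * π * I * k / p) ^ p = 1 := by
      rw [← Complex.exp_nat_mul, Complex.exp_eq_one_iff]
      refine ⟨k, ?_⟩
      field_simp
    rw [geom_sum_eq h1, h2, sub_self, zero_div]

/-- The only place where the value 22 matters: all p terms acquire the same weight p^21. -/
lemma twistedPartitionFunction_eq {S : AlgebraicGeometry.Scheme.{u}} (hS : picardNumber S = 22)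
    {p : ℕ} (hp : 0 < p) (τ : ℂ) :
    twistedPartitionFunction S p τ =
      Complex.exp (2 * π * I * p * τ) / (p : ℂ) ^ 2 * etaInv24 (p * τ) +
        Complex.exp (2 * π * I * p * τ) * (p : ℂ) ^ 21 *
          ∑ j ∈ Finset.range p, etaInv24 ((τ + j) / p) := by
  have h21 : (p : ℂ) ^ ((picardNumber S : ℤ) - 1) = (p : ℂ) ^ 21 := by
    rw [hS]
    norm_num
  obtain ⟨r, rfl⟩ : ∃ r, p = r + 1 := ⟨p - 1, by omega⟩
  have hsum : ∑ j ∈ Finset.range (r + 1), etaInv24 ((τ + j) / (r + 1 : ℕ)) =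
      etaInv24 (τ / (r + 1 : ℕ)) +
        ∑ j ∈ Finset.Icc 1 (r + 1 - 1), etaInv24 ((τ + j) / (r + 1 : ℕ)) := by
    have hI : Finset.Icc 1 (r + 1 - 1) = Finset.Ico (0 + 1) (r + 1) := by
      ext
      simp only [Finset.mem_Icc, Finset.mem_Ico]
      omega
    rw [hI, Finset.range_eq_Ico, Finset.sum_eq_sum_Ico_succ_bot (Nat.succ_pos r)]
    simp
  rw [twistedPartitionFunction, h21, hsum]
  ring

/-- The coefficient of `qⁿ` in the twisted partition function of a supersingular K3 surface. -/
noncomputable def supersingularCoeff (p : ℕ) (n : ℤ) : ℂ :=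
  (p : ℂ) ^ 22 * etaCoeff (p * (n - p)) +
    if (p : ℤ) ∣ n then 1 / (p : ℂ) ^ 2 * etaCoeff (n / p - 1) else 0

lemma hasSum_etaInv24_mul {p : ℕ} (hp : 0 < p) {τ : ℂ} (hτ : 0 < τ.im) :
    HasSum (fun n : ℤ => (if (p : ℤ) ∣ n then 1 / (p : ℂ) ^ 2 * etaCoeff (n / p - 1) else 0) *
        Complex.exp (2 * π * I * n * τ))
      (Complex.exp (2 * π * I * p * τ) / (p : ℂ) ^ 2 * etaInv24 (p * τ)) := by
  have hpz : (p : ℤ) ≠ 0 := by exact_mod_cast hp.ne'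
  have h := (hasSum_etaInv24 (τ := p * τ) (by
    have : (0 : ℝ) < p := by exact_mod_cast hp
    simpa using mul_pos this hτ)).mul_left (Complex.exp (2 * π * I * p * τ) / (p : ℂ) ^ 2)
  have hinj : Function.Injective fun k : ℤ => (p : ℤ) * (k + 1) := fun a b hab => by
    have := mul_left_cancel₀ hpz hab
    omega
  rw [← hinj.hasSum_iff]
  · refine h.congr_fun fun k => ?_
    simp only [Function.comp]
    rw [if_pos (dvd_mul_right _ _), Int.mul_ediv_cancel_left _ hpz, add_sub_cancel_right]
    have : Complex.exp (2 * π * I * ((p * (k + 1) : ℤ) : ℂ) * τ) =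
        Complex.exp (2 * π * I * p * τ) * Complex.exp (2 * π * I * k * (p * τ)) := by
      rw [← Complex.exp_add]
      congr 1
      push_cast
      ring
    rw [this]
    ring
  · intro n hn
    rw [if_neg, zero_mul]
    rintro ⟨m, rfl⟩
    exact hn ⟨m - 1, by simp⟩

lemma hasSum_sum_etaInv24_div {p : ℕ} (hp : 0 < p) {τ : ℂ} (hτ : 0 < τ.im) :
    HasSum (fun n : ℤ => (p : ℂ) ^ 22 * etaCoeff (p * (n - p)) * Complex.exp (2 * π * I * n * τ))
      (Complex.exp (2 * π * I * p * τ) * (p : ℂ) ^ 21 *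
          ∑ j ∈ Finset.range p, etaInv24 ((τ + j) / p)) := by
  have hpz : (p : ℤ) ≠ 0 := by exact_mod_cast hp.ne'
  have hpc : (p : ℂ) ≠ 0 := by exact_mod_cast hp.ne'
  have hpr : (0 : ℝ) < p := by exact_mod_cast hp
  have h1 : HasSum (fun k : ℤ => etaCoeff k * Complex.exp (2 * π * I * k * τ / p) *
      ∑ j ∈ Finset.range p, Complex.exp (2 * π * I * k * j / p))
      (∑ j ∈ Finset.range p, etaInv24 ((τ + j) / p)) := by
    have := hasSum_sum (s := Finset.range p) fun (j : ℕ) _ =>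
      hasSum_etaInv24 (τ := (τ + j) / p) (by
        rw [show (p : ℂ) = ((p : ℝ) : ℂ) by simp, Complex.div_ofReal_im]
        simpa using div_pos hτ hpr)
    refine this.congr_fun fun k => ?_
    rw [Finset.mul_sum]
    refine Finset.sum_congr rfl fun j _ => ?_
    rw [mul_assoc, ← Complex.exp_add]
    congr 2
    ring
  simp only [sum_exp_two_pi_I_mul_div hp] at h1
  -- A surviving exponent k = p(n - p) contributes q^p · q^(k/p) = q^n.
  have hinj : Function.Injective fun n : ℤ => (p : ℤ) * (n - p) := fun a b hab => by
    have := mul_left_cancel₀ hpz hab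
    omega
  rw [← hinj.hasSum_iff] at h1
  · refine (h1.mul_left (Complex.exp (2 * π * I * p * τ) * (p : ℂ) ^ 21)).congr_fun fun n => ?_
    simp only [Function.comp]
    rw [if_pos (dvd_mul_right _ _)]
    have : Complex.exp (2 * π * I * n * τ) = Complex.exp (2 * π * I * p * τ) *
        Complex.exp (2 * π * I * ((p * (n - p) : ℤ) : ℂ) * τ / p) := by
      rw [← Complex.exp_add]
      congr 1
      push_cast
      field_simp
      ring
    rw [this]
    ring
  · intro n hn
    rw [if_neg, mul_zero]
    rintro ⟨m, rfl⟩
    exact hn ⟨m + p, by simp⟩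

lemma hasSum_twistedPartitionFunction {S : AlgebraicGeometry.Scheme.{u}}
    (hS : picardNumber S = 22) {p : ℕ} (hp : 0 < p) {τ : ℂ} (hτ : 0 < τ.im) :
    HasSum (fun n : ℤ => supersingularCoeff p n * Complex.exp (2 * π * I * n * τ))
      (twistedPartitionFunction S p τ) := by
  rw [twistedPartitionFunction_eq hS hp]
  refine ((hasSum_etaInv24_mul hp hτ).add (hasSum_sum_etaInv24_div hp hτ)).congr_fun fun n => ?_
  rw [supersingularCoeff]
  ring

lemma hasSum_alpha3 {S : AlgebraicGeometry.Scheme.{u}} (hS : picardNumber S = 22) {p : ℕ}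
    (hp : 0 < p) (n : ℤ) :
    HasSum (fun i : ℤ => if (p : ℤ) * i = n then supersingularCoeff p i else 0) (alpha3 S p n) := by
  have hpc : (p : ℂ) ≠ 0 := by exact_mod_cast hp.ne'
  have hpr : (0 : ℝ) < p := by exact_mod_cast hp
  have := hasSum_integral_mul_exp hpr 0 (y := 1) (c := supersingularCoeff p)
    (k := fun i => (p : ℤ) * i) (F := fun x => twistedPartitionFunction S p (x + I))
    (fun x => by
      refine (hasSum_twistedPartitionFunction hS hp (τ := x + I) (by simp)).congr_fun fun i => ?_
      congr 2
      push_cast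
      field_simp) n
  rw [alpha3, fourierCoefficient]
  simp only [Complex.ofReal_one, one_mul, zero_add] at this
  refine (this.mul_left (1 / ((p : ℝ) : ℂ))).congr_fun fun i => ?_
  split_ifs
  · push_cast
    field_simp
  · simp

lemma alpha3_eq_zero {S : AlgebraicGeometry.Scheme.{u}} (hS : picardNumber S = 22) {p : ℕ}
    (hp : 0 < p) {n : ℤ} (hn : ¬ (p : ℤ) ∣ n) : alpha3 S p n = 0 := by
  refine (hasSum_alpha3 hS hp n).unique (hasSum_zero.congr_fun fun i => ?_)
  rw [if_neg]
  rintro rfl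
  exact hn (dvd_mul_right _ _)

lemma alpha3'_eq {S : AlgebraicGeometry.Scheme.{u}} (hS : picardNumber S = 22) {p : ℕ}
    (hp : 0 < p) (n : ℤ) : alpha3' S p n = supersingularCoeff p n := by
  have hpz : (p : ℤ) ≠ 0 := by exact_mod_cast hp.ne'
  refine (hasSum_alpha3 hS hp _).unique ((hasSum_ite_eq n _).congr_fun fun i => ?_)
  simp only [mul_right_inj' hpz]
  split_ifs with h
  · rw [h]
  · rfl

lemma supersingularCoeff_eq_zero {p : ℕ} (hp : 2 ≤ p) {n : ℤ} (hn : n < 0) :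
    supersingularCoeff p n = 0 := by
  have hpz : (2 : ℤ) ≤ p := by exact_mod_cast hp
  rw [supersingularCoeff, etaCoeff_eq_zero (by nlinarith), mul_zero, zero_add]
  split_ifs with h
  · obtain ⟨m, rfl⟩ := h
    rw [Int.mul_ediv_cancel_left _ (by omega), etaCoeff_eq_zero, mul_zero]
    have : m < 0 := by nlinarith
    omega
  · rfl

lemma hasSum_alpha3' {S : AlgebraicGeometry.Scheme.{u}} (hS : picardNumber S = 22) {p : ℕ}
    (hp : 2 ≤ p) {τ : ℂ} (hτ : 0 < τ.im) :
    HasSum (fun n : ℕ => alpha3' S p n * Complex.exp (2 * π * I * n * τ))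
      (twistedPartitionFunction S p τ) := by
  have hp0 : 0 < p := by omega
  have h := hasSum_twistedPartitionFunction hS hp0 hτ
  have hinj : Function.Injective fun n : ℕ => (n : ℤ) := Nat.cast_injective
  rw [← hinj.hasSum_iff] at h
  · refine h.congr_fun fun n => ?_
    simp only [Function.comp, alpha3'_eq hS hp0, Int.cast_natCast]
  · intro n hn
    rw [supersingularCoeff_eq_zero hp, zero_mul]
    by_contra hneg
    exact hn ⟨n.toNat, by simp; omega⟩

/-! ### Asymptotics of the modified Bessel function -/

lemma hasSum_exp_mul_exp (z w : ℂ) :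
    HasSum (fun i : ℕ × ℕ => z ^ i.1 / (i.1.factorial : ℂ) * (w ^ i.2 / (i.2.factorial : ℂ)))
      (Complex.exp z * Complex.exp w) := by
  have h1 (z : ℂ) : HasSum (fun n : ℕ => z ^ n / (n.factorial : ℂ)) (Complex.exp z) := by
    have := NormedSpace.expSeries_div_hasSum_exp z
    rwa [← Complex.exp_eq_exp_ℂ] at this
  have h2 {f g : ℕ → ℂ} {a b : ℂ} (hf : HasSum f a) (hg : HasSum g b) :
      HasSum (fun i : ℕ × ℕ => f i.1 * g i.2) (a * b) :=
    hf.mul hg (summable_mul_of_summable_norm hf.summable.norm hg.summable.norm)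
  exact h2 (f := fun n => z ^ n / (n.factorial : ℂ)) (g := fun n => w ^ n / (n.factorial : ℂ))
    (h1 z) (h1 w)

/-- Multiply the series of exp((x/2)e^(iθ)) and exp((x/2)e^(-iθ)). The term (a, b) has frequency a -
b; the period 2π and height 0 are written out to match `hasSum_integral_mul_exp`. -/
lemma hasSum_exp_mul_cos (x θ : ℝ) :
    HasSum (fun i : ℕ × ℕ => ((x / 2 : ℂ) ^ (i.1 + i.2) / (i.1.factorial * i.2.factorial)) *
        Complex.exp (2 * π * I * ((i.1 - i.2 : ℤ) : ℂ) * (θ + (0 : ℝ) * I) / (2 * π : ℝ)))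
      (Complex.exp (x * Complex.cos θ)) := by
  have h := hasSum_exp_mul_exp (x / 2 * Complex.exp (θ * I)) (x / 2 * Complex.exp (-θ * I))
  rw [← Complex.exp_add, ← mul_add, show (x / 2 : ℂ) * (Complex.exp (θ * I) +
    Complex.exp (-θ * I)) = x * Complex.cos θ by rw [Complex.cos]; ring] at h
  refine h.congr_fun fun i => ?_
  have hpi : (π : ℂ) ≠ 0 := by exact_mod_cast Real.pi_ne_zero
  have e : Complex.exp (2 * π * I * ((i.1 - i.2 : ℤ) : ℂ) * (θ + (0 : ℝ) * I) / (2 * π : ℝ)) =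
      Complex.exp (θ * I) ^ i.1 * Complex.exp (-θ * I) ^ i.2 := by
    rw [← Complex.exp_nat_mul, ← Complex.exp_nat_mul, ← Complex.exp_add]
    congr 1
    push_cast
    field_simp
    ring
  rw [e, mul_pow, mul_pow, pow_add, div_mul_div_comm, mul_mul_mul_comm, div_mul_eq_mul_div]

lemma integral_exp_mul_cos_mul_exp (ν : ℕ) (x t : ℝ) :
    ∫ θ in t..t + 2 * π, Complex.exp (x * Complex.cos θ) * Complex.exp (-(ν * θ * I)) =
      2 * π * (besselI ν x : ℂ) := by
  have h := hasSum_integral_mul_exp Real.two_pi_pos t (hasSum_exp_mul_cos x) ν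
  -- The pairs of frequency ν are exactly (b + ν, b), and they reproduce the Bessel series.
  have hinj : Function.Injective fun b : ℕ => (b + ν, b) := fun a b hab => (Prod.ext_iff.mp hab).2
  rw [← hinj.hasSum_iff] at h
  · have hpi : (π : ℂ) ≠ 0 := by exact_mod_cast Real.pi_ne_zero
    have e (θ : ℝ) : -(2 * π * I * (ν : ℤ) * (θ + (0 : ℝ) * I) / (2 * π : ℝ)) = -(ν * θ * I) := by
      push_cast
      field_simp
      ring
    simp only [e] at h
    rw [← h.tsum_eq, besselI, Complex.ofReal_tsum, ← tsum_mul_left]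
    refine tsum_congr fun b => ?_
    simp only [Function.comp]
    rw [if_pos (by push_cast; ring)]
    push_cast
    rw [show b + ν + b = 2 * b + ν by ring]
    ring
  · rintro ⟨a, b⟩ hab
    rw [if_neg]
    intro h
    simp only at h
    exact hab ⟨b, by simp; omega⟩

lemma tendsto_mul_one_sub_cos_div_sqrt (s : ℝ) :
    Tendsto (fun x : ℝ => x * (1 - Real.cos (s / √x))) atTop (𝓝 (s ^ 2 / 2)) := by
  rw [tendsto_iff_norm_sub_tendsto_zero]
  have hlim : Tendsto (fun x : ℝ => s ^ 4 * (5 / 96) / x) atTop (𝓝 0) :=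
    tendsto_const_nhds.div_atTop tendsto_id
  refine squeeze_zero' (Eventually.of_forall fun _ => norm_nonneg _) ?_ hlim
  filter_upwards [eventually_ge_atTop (s ^ 2), eventually_gt_atTop 0] with x hx hx0
  have hsq : √x ^ 2 = x := Real.sq_sqrt hx0.le
  have hsqrt : 0 < √x := Real.sqrt_pos.mpr hx0
  have hu : |s / √x| ≤ 1 := by
    rw [abs_div, abs_of_pos hsqrt, div_le_one hsqrt]
    exact Real.abs_le_sqrt hx
  have h := Real.cos_bound hu
  have e : x * (1 - Real.cos (s / √x)) - s ^ 2 / 2 =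
      -(x * (Real.cos (s / √x) - (1 - (s / √x) ^ 2 / 2))) := by
    have : x * (s / √x) ^ 2 = s ^ 2 := by
      rw [div_pow, hsq]
      field_simp
    linear_combination (1 / 2 : ℝ) * this
  rw [e, norm_neg, norm_mul, Real.norm_eq_abs, Real.norm_eq_abs, abs_of_pos hx0]
  calc x * |Real.cos (s / √x) - (1 - (s / √x) ^ 2 / 2)| ≤ x * (|s / √x| ^ 4 * (5 / 96)) := by
        gcongr
    _ = s ^ 4 * (5 / 96) / x := by
        rw [show |s / √x| ^ 4 = (s / √x) ^ 4 from Even.pow_abs (by decide) _, div_pow,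
          show √x ^ 4 = (√x ^ 2) ^ 2 by ring, hsq]
        field_simp

lemma sqrt_mul_exp_neg_mul_integral (ν : ℕ) {x : ℝ} (hx : 0 < x) :
    (√x * Real.exp (-x) : ℝ) * (2 * π * (besselI ν x : ℂ)) =
      ∫ s : ℝ, (Set.Ioc (-(π * √x)) (π * √x)).indicator (fun s : ℝ =>
        Complex.exp (-(x * (1 - Real.cos (s / √x)) : ℝ)) * Complex.exp (-(ν * (s / √x) * I))) s := by
  have hsqrt : 0 < √x := Real.sqrt_pos.mpr hx
  rw [MeasureTheory.integral_indicator measurableSet_Ioc,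
    ← intervalIntegral.integral_of_le (by nlinarith [Real.pi_pos]),
    ← integral_exp_mul_cos_mul_exp ν x (-π), ← intervalIntegral.integral_const_mul]
  have := intervalIntegral.integral_comp_div (a := -(π * √x)) (b := π * √x) (fun θ : ℝ =>
    Complex.exp (-(x * (1 - Real.cos θ) : ℝ)) * Complex.exp (-(ν * θ * I))) hsqrt.ne'
  simp only [Complex.ofReal_div] at this
  rw [this, show -(π * √x) / √x = -π by field_simp, show π * √x / √x = -π + 2 * π by
    field_simp; ring, ← intervalIntegral.integral_smul]
  refine intervalIntegral.integral_congr fun θ _ => ?_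
  simp only [Complex.real_smul]
  rw [← mul_assoc, Complex.ofReal_mul, mul_assoc (√x : ℂ), Complex.ofReal_exp, ← Complex.exp_add,
    ← mul_assoc]
  congr 3
  push_cast
  ring

/-- Laplace's method. After θ = s/√x the integrand tends pointwise to e^(-s²/2), and cos θ ≤ 1 -
2θ²/π² on [-π, π] supplies the integrable majorant e^(-2s²/π²). -/
lemma tendsto_besselI (ν : ℕ) :
    Tendsto (fun x : ℝ => besselI ν x * (√(2 * π * x) * Real.exp (-x))) atTop (𝓝 1) := by
  have hb : MeasureTheory.Integrable fun s : ℝ => Real.exp (-(2 / π ^ 2) * s ^ 2) :=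
    integrable_exp_neg_mul_sq (by positivity)
  have key : Tendsto (fun x : ℝ => ∫ s : ℝ, (Set.Ioc (-(π * √x)) (π * √x)).indicator (fun s : ℝ =>
      Complex.exp (-(x * (1 - Real.cos (s / √x)) : ℝ)) * Complex.exp (-(ν * (s / √x) * I))) s)
      atTop (𝓝 (∫ s : ℝ, Complex.exp (-(s ^ 2 / 2 : ℝ)))) := by
    refine MeasureTheory.tendsto_integral_filter_of_dominated_convergence _ ?_ ?_ hb ?_
    · refine Eventually.of_forall fun x => ?_
      refine (Continuous.aestronglyMeasurable ?_).indicator measurableSet_Ioc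
      fun_prop
    · filter_upwards [eventually_gt_atTop 0] with x hx
      refine Eventually.of_forall fun s => ?_
      have hsqrt : 0 < √x := Real.sqrt_pos.mpr hx
      by_cases hs : s ∈ Set.Ioc (-(π * √x)) (π * √x)
      · rw [Set.indicator_of_mem hs, norm_mul, Complex.norm_exp, Complex.norm_exp]
        have hre : (-(ν * (s / √x : ℂ) * I)).re = 0 := by
          rw [← Complex.ofReal_div, ← Complex.ofReal_natCast, ← Complex.ofReal_mul]
          simp
        rw [hre, Real.exp_zero, mul_one, Complex.neg_re, Complex.ofReal_re]
        apply Real.exp_le_exp.mpr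
        have hu : |s / √x| ≤ π := by
          rw [abs_div, abs_of_pos hsqrt, div_le_iff₀ hsqrt]
          exact abs_le.mpr ⟨hs.1.le, hs.2⟩
        have h1 := Real.cos_le_one_sub_mul_cos_sq hu
        have h2 : x * (s / √x) ^ 2 = s ^ 2 := by
          rw [div_pow, Real.sq_sqrt hx.le]
          field_simp
        have h3 : x * (2 / π ^ 2 * (s / √x) ^ 2) ≤ x * (1 - Real.cos (s / √x)) := by
          apply mul_le_mul_of_nonneg_left _ hx.le
          linarith
        rw [mul_left_comm, h2] at h3
        linarith
      · rw [Set.indicator_of_notMem hs, norm_zero]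
        positivity
    · refine Eventually.of_forall fun s => ?_
      have h1 : Tendsto (fun x : ℝ => Complex.exp (-(x * (1 - Real.cos (s / √x)) : ℝ)) *
          Complex.exp (-(ν * (s / √x) * I))) atTop (𝓝 (Complex.exp (-(s ^ 2 / 2 : ℝ)) *
            Complex.exp (-(ν * (0 : ℝ) * I)))) := by
        have hs : Tendsto (fun x : ℝ => s / √x) atTop (𝓝 0) :=
          tendsto_const_nhds.div_atTop Real.tendsto_sqrt_atTop
        refine Tendsto.mul ?_ ?_
        · refine (Complex.continuous_exp.tendsto _).comp (Tendsto.neg ?_)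
          exact (Complex.continuous_ofReal.tendsto _).comp (tendsto_mul_one_sub_cos_div_sqrt s)
        · have : Continuous fun u : ℝ => Complex.exp (-(ν * (u : ℂ) * I)) := by fun_prop
          simpa only [Function.comp_def, Complex.ofReal_div] using (this.tendsto 0).comp hs
      simp only [Complex.ofReal_zero, mul_zero, zero_mul, neg_zero, Complex.exp_zero, mul_one] at h1
      refine h1.congr' ?_
      have h2 : Tendsto (fun x : ℝ => π * √x) atTop atTop :=
        Real.tendsto_sqrt_atTop.const_mul_atTop Real.pi_pos
      filter_upwards [h2.eventually_gt_atTop |s|] with x hx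
      rw [Set.indicator_of_mem]
      exact ⟨(abs_lt.mp hx).1, (abs_lt.mp hx).2.le⟩
  have hgauss : ∫ s : ℝ, Complex.exp (-(s ^ 2 / 2 : ℝ)) = (√(2 * π) : ℝ) := by
    have := integral_gaussian (1 / 2)
    rw [show π / (1 / 2) = 2 * π by ring] at this
    rw [← this, ← integral_complex_ofReal]
    congr 1
    funext s
    push_cast
    congr 1
    ring
  rw [hgauss] at key
  have h2 : Tendsto (fun x : ℝ => (((√x * Real.exp (-x)) * (2 * π * besselI ν x) : ℝ) : ℂ)) atTop
      (𝓝 (√(2 * π) : ℝ)) := by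
    refine key.congr' ?_
    filter_upwards [eventually_gt_atTop 0] with x hx
    rw [← sqrt_mul_exp_neg_mul_integral ν hx]
    push_cast
    ring
  have h3 := (Complex.continuous_re.tendsto _).comp h2
  simp only [Function.comp_def, Complex.ofReal_re] at h3
  have h4 := h3.div_const √(2 * π)
  have hpos : √(2 * π) ≠ 0 := (Real.sqrt_pos.mpr Real.two_pi_pos).ne'
  rw [div_self hpos] at h4
  refine h4.congr fun x => ?_
  rw [Real.sqrt_mul Real.two_pi_pos.le]
  have hsq : √(2 * π) ^ 2 = 2 * π := Real.sq_sqrt Real.two_pi_pos.le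
  field_simp
  rw [hsq]
  ring

/-! ### The principal series -/

/-- The weights in the power series defining the leading term of the coefficients of `η⁻²⁴`. -/
noncomputable def besselWeight (l : ℕ) : ℝ :=
  (2 * π) ^ (2 * l + 14) / (l.factorial * (l + 13).factorial)

lemma besselWeight_nonneg (l : ℕ) : 0 ≤ besselWeight l := by
  unfold besselWeight
  positivity

/-- The leading term of the coefficients of `η⁻²⁴`. -/
noncomputable def mainCoeff (m : ℕ) : ℝ := ∑' l : ℕ, besselWeight l * (m : ℝ) ^ l

/-- The function whose Fourier coefficients are the leading terms `mainCoeff`. -/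
noncomputable def mainSeries (τ : ℂ) : ℂ :=
  ∑' l : ℕ, besselWeight l * ∑' m : ℕ, (m : ℂ) ^ l * Complex.exp (2 * π * I * τ) ^ m

lemma mainCoeff_eq_besselI {m : ℕ} (hm : 0 < m) :
    mainCoeff m = 2 * π / (m : ℝ) ^ (13 / 2 : ℝ) * besselI 13 (4 * π * √m) := by
  have hm' : (0 : ℝ) < m := by exact_mod_cast hm
  rw [mainCoeff, besselI, ← tsum_mul_left]
  refine tsum_congr fun l => ?_
  have hs : (m : ℝ) ^ (13 / 2 : ℝ) = √m ^ 13 := by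
    rw [Real.sqrt_eq_rpow, ← Real.rpow_natCast, ← Real.rpow_mul hm'.le]
    norm_num
  have hsq : (m : ℝ) ^ l = √m ^ (2 * l) := by
    rw [pow_mul, Real.sq_sqrt hm'.le]
  have h0 : √(m : ℝ) ≠ 0 := (Real.sqrt_pos.mpr hm').ne'
  rw [hs, besselWeight, hsq, show 4 * π * √m / 2 = 2 * π * √m by ring,
    mul_pow (2 * π) √(m : ℝ), show 2 * l + 14 = 2 * l + 13 + 1 by ring, pow_succ (2 * π), pow_add (√(m : ℝ))]
  field_simp

lemma summable_besselWeight_mul {τ : ℂ} (hτ : 0 < τ.im) :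
    Summable fun i : ℕ × ℕ => (besselWeight i.2 : ℂ) *
      ((i.1 : ℂ) ^ i.2 * Complex.exp (2 * π * I * τ) ^ i.1) := by
  have hε : 0 < π * τ.im := by positivity
  have h1 : Summable fun m : ℕ => Real.exp (-(π * τ.im)) ^ m :=
    summable_geometric_of_lt_one (Real.exp_nonneg _) (Real.exp_lt_one_iff.mpr (by linarith))
  have h2 : Summable fun l : ℕ => (2 * π) ^ 14 * (((2 * π) ^ 2 / (π * τ.im)) ^ l / l.factorial) :=
    (Real.summable_pow_div_factorial _).mul_left _
  have h := h1.mul_of_nonneg h2 (fun m => by positivity) (fun l => by positivity)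
  refine Summable.of_norm_bounded h ?_
  rintro ⟨m, l⟩
  simp only
  have hq : ‖Complex.exp (2 * π * I * τ)‖ = Real.exp (-(2 * π * τ.im)) := by
    have := norm_exp_two_pi_I 1 1 τ.re τ.im
    simpa using this
  rw [norm_mul, norm_mul, norm_pow, norm_pow, hq, Complex.norm_natCast, Complex.norm_real,
    Real.norm_of_nonneg (besselWeight_nonneg l)]
  -- Half of the decay of q^m is spent on m^l through ε^l m^l / l! ≤ e^(εm) with ε = π Im τ; the
  -- other half leaves a geometric series in m. One of the two factorials in the weight pays for l!.
  have h3 : (m : ℝ) ^ l ≤ l.factorial / (π * τ.im) ^ l * Real.exp (π * τ.im) ^ m := by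
    have := Real.pow_div_factorial_le_exp (x := π * τ.im * m) (by positivity) l
    rw [mul_comm (π * τ.im) (m : ℝ), Real.exp_nat_mul, mul_pow] at this
    rw [div_mul_eq_mul_div, le_div_iff₀ (by positivity)]
    rwa [div_le_iff₀ (by positivity), mul_comm (Real.exp _ ^ m)] at this
  have h4 : besselWeight l ≤ (2 * π) ^ 14 * ((2 * π) ^ 2) ^ l / (l.factorial * l.factorial) := by
    rw [besselWeight, pow_add, pow_mul, mul_comm (((2 * π) ^ 2) ^ l)]
    gcongr
    omega
  have h5 : Real.exp (-(2 * π * τ.im)) ^ m = Real.exp (-(π * τ.im)) ^ m *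
      Real.exp (-(π * τ.im)) ^ m := by
    rw [← mul_pow, ← Real.exp_add]
    ring_nf
  have h6 : Real.exp (π * τ.im) ^ m * Real.exp (-(π * τ.im)) ^ m = 1 := by
    rw [← mul_pow, ← Real.exp_add]
    simp
  calc besselWeight l * ((m : ℝ) ^ l * Real.exp (-(2 * π * τ.im)) ^ m)
      ≤ ((2 * π) ^ 14 * ((2 * π) ^ 2) ^ l / (l.factorial * l.factorial)) *
        ((l.factorial / (π * τ.im) ^ l * Real.exp (π * τ.im) ^ m) *
          Real.exp (-(2 * π * τ.im)) ^ m) := by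
        gcongr
    _ = ((2 * π) ^ 14 * ((2 * π) ^ 2) ^ l / (l.factorial * l.factorial)) *
        (l.factorial / (π * τ.im) ^ l) * Real.exp (-(π * τ.im)) ^ m := by
        rw [h5]
        linear_combination ((2 * π) ^ 14 * ((2 * π) ^ 2) ^ l / (l.factorial * l.factorial)) *
          (l.factorial / (π * τ.im) ^ l) * Real.exp (-(π * τ.im)) ^ m * h6
    _ = _ := by
        rw [div_pow]
        have : (l.factorial : ℝ) ≠ 0 := by positivity
        field_simp

lemma hasSum_mainSeries {τ : ℂ} (hτ : 0 < τ.im) :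
    HasSum (fun m : ℕ => (mainCoeff m : ℂ) * Complex.exp (2 * π * I * m * τ)) (mainSeries τ) := by
  have hs := summable_besselWeight_mul hτ
  have h1 := hs.hasSum.prod_fiberwise fun m => (hs.prod_factor m).hasSum
  have h2 : ∑' i : ℕ × ℕ, (besselWeight i.2 : ℂ) *
      ((i.1 : ℂ) ^ i.2 * Complex.exp (2 * π * I * τ) ^ i.1) = mainSeries τ := by
    have hs' := hs.prod_symm
    rw [mainSeries, ← (Equiv.prodComm ℕ ℕ).tsum_eq]
    refine (Summable.tsum_prod hs').trans (tsum_congr fun l => ?_)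
    simp only [Prod.swap]
    rw [tsum_mul_left]
  rw [h2] at h1
  refine h1.congr_fun fun m => ?_
  rw [mainCoeff, Complex.ofReal_tsum, ← tsum_mul_right]
  refine tsum_congr fun l => ?_
  rw [← Complex.exp_nat_mul]
  push_cast
  rw [mul_assoc]
  congr 3
  ring

lemma half_abs_le_norm_add_intCast {τ : ℂ} (hre : |τ.re| ≤ 1 / 2) {n : ℤ} (hn : n ≠ 0) :
    |(n : ℝ)| / 2 ≤ ‖τ + n‖ := by
  have h1 : |(τ + n).re| ≤ ‖τ + n‖ := Complex.abs_re_le_norm _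
  have h2 : (1 : ℝ) ≤ |(n : ℝ)| := by
    exact_mod_cast Int.one_le_abs hn
  have h3 : |(n : ℝ)| ≤ |(τ + n).re| + |τ.re| := by
    have : (n : ℝ) = (τ + n).re - τ.re := by simp
    calc |(n : ℝ)| = |(τ + n).re - τ.re| := by rw [← this]
      _ ≤ _ := abs_sub _ _
  linarith

lemma norm_le_two {τ : ℂ} (hre : |τ.re| ≤ 1 / 2) (him : 0 < τ.im) (him' : τ.im ≤ 1) :
    ‖τ‖ ≤ 2 := by
  have := Complex.norm_le_abs_re_add_abs_im τ
  rw [abs_of_pos him] at this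
  linarith

/-- Lipschitz's formula writes Σ m^l q^m as l!/(-2πi)^(l+1) times Σ 1/(τ + n)^(l+1), and the term n
= 0 is the polar part. In the strip |τ + n| ≥ |n|/2 for n ≠ 0, and the resulting 2^(l+1) is absorbed
by (2π)^(l+1). Uniformity in l up to l! is needed because the estimate is summed against
`besselWeight`. -/
lemma exists_norm_tsum_pow_mul_exp_sub_le :
    ∃ K : ℝ, 0 < K ∧ ∀ l : ℕ, ∀ τ : ℂ, |τ.re| ≤ 1 / 2 → 0 < τ.im → τ.im ≤ 1 →
      ‖∑' m : ℕ, (m : ℂ) ^ l * Complex.exp (2 * π * I * τ) ^ m -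
        l.factorial / ((-2 * π * I) ^ (l + 1) * τ ^ (l + 1))‖ ≤ K * l.factorial := by
  have hZ : Summable fun n : ℤ => 1 / (n : ℝ) ^ 2 :=
    Real.summable_one_div_int_pow.mpr (by norm_num)
  have hN : Summable fun n : ℕ => 1 / ((n : ℝ) + 1) ^ 2 := by
    have := (summable_nat_add_iff 1).mpr (Real.summable_one_div_nat_pow.mpr (by norm_num : 1 < 2))
    simpa using this
  refine ⟨∑' n : ℤ, 1 / (n : ℝ) ^ 2 + (1 + 16 * ∑' n : ℕ, 1 / ((n : ℝ) + 1) ^ 2), by positivity, ?_⟩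
  have hZ0 : 0 ≤ ∑' n : ℤ, 1 / (n : ℝ) ^ 2 := tsum_nonneg fun n => by positivity
  have hN0 : 0 ≤ ∑' n : ℕ, 1 / ((n : ℝ) + 1) ^ 2 := tsum_nonneg fun n => by positivity
  intro l τ hre him him'
  have hpi : (π : ℂ) ≠ 0 := by exact_mod_cast Real.pi_ne_zero
  have hτ0 : τ ≠ 0 := fun h => by simp [h] at him
  rcases Nat.eq_zero_or_pos l with rfl | hl
  -- For l = 0 the sum over n is not absolutely convergent; the cotangent expansion, which pairs n
  -- with -n, replaces it.
  · have hc := pi_mul_cot_pi_q_exp ⟨τ, him⟩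
    have hmem : τ ∈ Complex.integerComplement :=
      UpperHalfPlane.coe_mem_integerComplement ⟨τ, him⟩
    have hs := cot_series_rep' hmem
    simp only at hc
    simp only [pow_zero, one_mul, zero_add, pow_one, Nat.factorial_zero, Nat.cast_one, mul_one]
    have e : ∑' m : ℕ, Complex.exp (2 * π * I * τ) ^ m - 1 / (-2 * π * I * τ) =
        1 / 2 - (π * Complex.cot (π * τ) - 1 / τ) / (2 * π * I) := by
      rw [hc]
      field_simp
      ring
    have hb : ‖π * Complex.cot (π * τ) - 1 / τ‖ ≤ 16 * ∑' n : ℕ, 1 / ((n : ℝ) + 1) ^ 2 := by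
      rw [hs]
      refine tsum_of_norm_bounded (hN.hasSum.mul_left 16) fun n => ?_
      have h1 := half_abs_le_norm_add_intCast hre (n := (n : ℤ) + 1) (by omega)
      have h2 := half_abs_le_norm_add_intCast hre (n := -((n : ℤ) + 1)) (by omega)
      push_cast at h1 h2
      rw [abs_neg] at h2
      rw [← sub_eq_add_neg] at h2
      rw [abs_of_pos (by positivity)] at h1 h2
      have hn : (0 : ℝ) < ((n : ℝ) + 1) / 2 := by positivity
      have n1 : τ - ((n : ℂ) + 1) ≠ 0 := norm_pos_iff.mp (hn.trans_le h2)
      have n2 : τ + ((n : ℂ) + 1) ≠ 0 := norm_pos_iff.mp (hn.trans_le h1)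
      have e2 : 1 / (τ - ((n : ℂ) + 1)) + 1 / (τ + ((n : ℂ) + 1)) =
          2 * τ / ((τ - ((n : ℂ) + 1)) * (τ + ((n : ℂ) + 1))) := by
        field_simp
        ring
      rw [e2, norm_div, norm_mul, norm_mul]
      have h3 : ‖τ‖ ≤ 2 := norm_le_two hre him him'
      calc ‖(2 : ℂ)‖ * ‖τ‖ / (‖τ - ((n : ℂ) + 1)‖ * ‖τ + ((n : ℂ) + 1)‖)
          ≤ 2 * 2 / ((((n : ℝ) + 1) / 2) * (((n : ℝ) + 1) / 2)) := by
            rw [Complex.norm_ofNat]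
            gcongr
        _ = 16 * (1 / ((n : ℝ) + 1) ^ 2) := by
            field_simp
            norm_num
    rw [e]
    have h2pi : (1 : ℝ) ≤ ‖(2 * π * I : ℂ)‖ := by
      simp only [norm_mul, Complex.norm_ofNat, Complex.norm_real, Complex.norm_I, mul_one,
        Real.norm_of_nonneg Real.pi_pos.le]
      linarith [Real.pi_gt_three]
    have h1 : ‖(1 / 2 : ℂ)‖ ≤ 1 := by norm_num
    have h2 : ‖(π * Complex.cot (π * τ) - 1 / τ) / (2 * π * I)‖ ≤
        ‖π * Complex.cot (π * τ) - 1 / τ‖ := by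
      rw [norm_div]
      exact div_le_self (norm_nonneg _) h2pi
    linarith [norm_sub_le (1 / 2 : ℂ) ((π * Complex.cot (π * τ) - 1 / τ) / (2 * π * I))]
  · have hid := EisensteinSeries.qExpansion_identity hl ⟨τ, him⟩
    simp only at hid
    have hbound : ∀ n : ℤ, ‖1 / (τ + n) ^ (l + 1) - (if n = 0 then 1 / τ ^ (l + 1) else 0)‖ ≤
        2 ^ (l + 1) * (1 / (n : ℝ) ^ 2) := by
      intro n
      split_ifs with hn
      -- At n = 0 both sides vanish, the right one because 1/0 = 0.
      · simp [hn]
      · have h1 := half_abs_le_norm_add_intCast hre hn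
        have h2 : (1 : ℝ) ≤ |(n : ℝ)| := by
          exact_mod_cast Int.one_le_abs hn
        rw [sub_zero, norm_div, norm_one, norm_pow]
        calc 1 / ‖τ + n‖ ^ (l + 1) ≤ 1 / (|(n : ℝ)| / 2) ^ (l + 1) := by gcongr
          _ = 2 ^ (l + 1) * (1 / |(n : ℝ)| ^ (l + 1)) := by
            rw [div_pow]
            field_simp
          _ ≤ 2 ^ (l + 1) * (1 / |(n : ℝ)| ^ 2) := by
            gcongr 2 ^ (l + 1) * (1 / ?_)
            exact pow_le_pow_right₀ h2 (by omega)
          _ = _ := by rw [sq_abs]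
    have hsum1 : Summable fun n : ℤ =>
        1 / (τ + n) ^ (l + 1) - (if n = 0 then 1 / τ ^ (l + 1) else 0) :=
      Summable.of_norm_bounded (hZ.mul_left _) hbound
    have hite := hasSum_ite_eq (0 : ℤ) (1 / τ ^ (l + 1))
    have htot := hsum1.hasSum.add hite
    simp only [sub_add_cancel] at htot
    have hR := tsum_of_norm_bounded (hZ.hasSum.mul_left (2 ^ (l + 1))) hbound
    rw [htot.tsum_eq] at hid
    have hne : (-2 * π * I : ℂ) ^ (l + 1) ≠ 0 := by
      apply pow_ne_zero
      simp [hpi]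
    have hfac : (l.factorial : ℂ) ≠ 0 := by exact_mod_cast l.factorial_ne_zero
    have e : ∑' m : ℕ, (m : ℂ) ^ l * Complex.exp (2 * π * I * τ) ^ m -
        l.factorial / ((-2 * π * I) ^ (l + 1) * τ ^ (l + 1)) =
        l.factorial / (-2 * π * I) ^ (l + 1) *
          ∑' n : ℤ, (1 / (τ + n) ^ (l + 1) - (if n = 0 then 1 / τ ^ (l + 1) else 0)) := by
      rw [eq_sub_of_add_eq hid]
      field_simp
    rw [e, norm_mul, norm_div, norm_pow, Complex.norm_natCast]
    have hn2 : ‖(-2 * π * I : ℂ)‖ = 2 * π := by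
      simp [abs_of_pos Real.pi_pos]
    rw [hn2]
    calc (l.factorial : ℝ) / (2 * π) ^ (l + 1) * ‖∑' n : ℤ, (1 / (τ + n) ^ (l + 1) -
          (if n = 0 then 1 / τ ^ (l + 1) else 0))‖
        ≤ (l.factorial : ℝ) / (2 * π) ^ (l + 1) * (2 ^ (l + 1) * ∑' n : ℤ, 1 / (n : ℝ) ^ 2) := by
          gcongr
      _ = (l.factorial * ∑' n : ℤ, 1 / (n : ℝ) ^ 2) / π ^ (l + 1) := by
          rw [mul_pow]
          field_simp
      _ ≤ (l.factorial * ∑' n : ℤ, 1 / (n : ℝ) ^ 2) := by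
          apply div_le_self (by positivity)
          exact one_le_pow₀ (by linarith [Real.pi_gt_three])
      _ ≤ _ := by
          rw [mul_comm]
          gcongr
          linarith

/-- The weights are chosen so that the l-th polar part is τ^12 (2πi/τ)^(l+13)/(l+13)!, using i^12 =
1. The sum is thus the exponential series without its first 13 terms; times τ^12 these form a
polynomial in τ, which stays bounded near 0. -/
lemma hasSum_besselWeight_mul_polar {τ : ℂ} (hτ : τ ≠ 0) :
    HasSum (fun l : ℕ => (besselWeight l : ℂ) *
        (l.factorial / ((-2 * π * I) ^ (l + 1) * τ ^ (l + 1))))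
      (τ ^ 12 * Complex.exp (2 * π * I / τ) -
        τ ^ 12 * ∑ j ∈ Finset.range 13, (2 * π * I / τ) ^ j / j.factorial) := by
  have h1 : HasSum (fun n : ℕ => (2 * π * I / τ) ^ n / (n.factorial : ℂ))
      (Complex.exp (2 * π * I / τ)) := by
    have := NormedSpace.expSeries_div_hasSum_exp (2 * π * I / τ : ℂ)
    rwa [← Complex.exp_eq_exp_ℂ] at this
  have h2 := ((hasSum_nat_add_iff' 13).mpr h1).mul_left (τ ^ 12)
  rw [mul_sub] at h2
  refine h2.congr_fun fun l => ?_
  have hpi : (π : ℂ) ≠ 0 := by exact_mod_cast Real.pi_ne_zero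
  have hfac : (l.factorial : ℂ) ≠ 0 := by exact_mod_cast l.factorial_ne_zero
  have hfac' : ((l + 13).factorial : ℂ) ≠ 0 := by exact_mod_cast (l + 13).factorial_ne_zero
  have hI : (2 * π * I : ℂ) ^ (l + 13) * (-2 * π * I) ^ (l + 1) = (2 * π : ℂ) ^ (2 * l + 14) := by
    have e1 : (2 * π * I : ℂ) ^ (l + 13) = (2 * π * I : ℂ) ^ (l + 1) * (2 * π) ^ 12 := by
      rw [show l + 13 = l + 1 + 12 by ring, pow_add, mul_pow (2 * π : ℂ) I 12,
        show I ^ 12 = (I ^ 2) ^ 6 by ring, Complex.I_sq]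
      norm_num
    rw [e1, mul_right_comm, ← mul_pow, show (2 * π * I : ℂ) * (-2 * π * I) =
      (2 * π) ^ 2 * -(I ^ 2) by ring, Complex.I_sq, neg_neg, mul_one, ← pow_mul, ← pow_add]
    ring_nf
  have hne : (-2 * π * I : ℂ) ^ (l + 1) ≠ 0 := by
    apply pow_ne_zero
    simp [hpi]
  rw [besselWeight]
  push_cast
  rw [← hI, div_pow, show τ ^ (l + 13) = τ ^ (l + 1) * τ ^ 12 by ring]
  field_simp

lemma exists_norm_mainSeries_sub_le :
    ∃ C : ℝ, 0 < C ∧ ∀ τ : ℂ, |τ.re| ≤ 1 / 2 → 0 < τ.im → τ.im ≤ 1 →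
      ‖mainSeries τ - τ ^ 12 * Complex.exp (2 * π * I / τ)‖ ≤ C := by
  obtain ⟨K, hK, hb⟩ := exists_norm_tsum_pow_mul_exp_sub_le
  have hw : Summable fun l : ℕ => besselWeight l * (K * l.factorial) := by
    have h1 : Summable fun l : ℕ => K * (2 * π) ^ 14 * (((2 * π) ^ 2) ^ l / l.factorial) :=
      (Real.summable_pow_div_factorial _).mul_left _
    refine Summable.of_nonneg_of_le (fun l => ?_) (fun l => ?_) h1
    · have := besselWeight_nonneg l
      positivity
    · have h2 : besselWeight l * (K * l.factorial) =
          K * (2 * π) ^ 14 * (((2 * π) ^ 2) ^ l / (l + 13).factorial) := by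
        rw [besselWeight, pow_add, pow_mul]
        have : (l.factorial : ℝ) ≠ 0 := by positivity
        field_simp
      rw [h2]
      gcongr
      omega
  refine ⟨∑' l : ℕ, besselWeight l * (K * l.factorial) +
    ∑ j ∈ Finset.range 13, 2 ^ (12 - j) * (2 * π) ^ j / j.factorial,
    add_pos_of_nonneg_of_pos (tsum_nonneg fun l => ?_) ?_, ?_⟩
  · have := besselWeight_nonneg l
    positivity
  · exact Finset.sum_pos (fun j _ => by positivity) (by simp)
  intro τ hre him him'
  have hτ0 : τ ≠ 0 := fun h => by simp [h] at him
  have hpolar := hasSum_besselWeight_mul_polar hτ0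
  have hdiff (l : ℕ) : ‖(besselWeight l : ℂ) * (∑' m : ℕ, (m : ℂ) ^ l *
      Complex.exp (2 * π * I * τ) ^ m - l.factorial / ((-2 * π * I) ^ (l + 1) * τ ^ (l + 1)))‖ ≤
      besselWeight l * (K * l.factorial) := by
    rw [norm_mul, Complex.norm_real, Real.norm_of_nonneg (besselWeight_nonneg l)]
    exact mul_le_mul_of_nonneg_left (hb l τ hre him him') (besselWeight_nonneg l)
  have hsd := (Summable.of_norm_bounded hw hdiff).hasSum
  have hR := tsum_of_norm_bounded hw.hasSum hdiff
  have htot := hsd.add hpolar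
  simp only [← mul_add, sub_add_cancel] at htot
  have hpoly : ‖τ ^ 12 * ∑ j ∈ Finset.range 13, (2 * π * I / τ) ^ j / (j.factorial : ℂ)‖ ≤
      ∑ j ∈ Finset.range 13, 2 ^ (12 - j) * (2 * π) ^ j / j.factorial := by
    rw [Finset.mul_sum]
    refine (norm_sum_le _ _).trans (Finset.sum_le_sum fun j hj => ?_)
    have hj' : j ≤ 12 := by
      have := Finset.mem_range.mp hj
      omega
    have e : τ ^ 12 * ((2 * π * I / τ) ^ j / (j.factorial : ℂ)) =
        τ ^ (12 - j) * (2 * π * I) ^ j / j.factorial := by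
      have h12 : τ ^ 12 = τ ^ (12 - j) * τ ^ j := by
        rw [← pow_add, Nat.sub_add_cancel hj']
      rw [h12, div_pow]
      field_simp
    rw [e, norm_div, norm_mul, norm_pow, norm_pow, Complex.norm_natCast]
    have hn2 : ‖(2 * π * I : ℂ)‖ = 2 * π := by
      simp [abs_of_pos Real.pi_pos]
    rw [hn2]
    gcongr
    exact norm_le_two hre him him'
  have hfin : mainSeries τ - τ ^ 12 * Complex.exp (2 * π * I / τ) =
      ∑' l : ℕ, (besselWeight l : ℂ) * (∑' m : ℕ, (m : ℂ) ^ l *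
        Complex.exp (2 * π * I * τ) ^ m - l.factorial / ((-2 * π * I) ^ (l + 1) * τ ^ (l + 1))) -
      τ ^ 12 * ∑ j ∈ Finset.range 13, (2 * π * I / τ) ^ j / j.factorial := by
    rw [mainSeries, htot.tsum_eq]
    ring
  rw [hfin]
  exact (norm_sub_le _ _).trans (add_le_add hR hpoly)

/-! ### The behaviour of `η⁻²⁴` near the real axis -/

lemma etaInv24_eq_pow_mul_neg_inv {τ : ℂ} (hτ : 0 < τ.im) :
    etaInv24 τ = τ ^ 12 * etaInv24 (-τ⁻¹) := by
  have h := etaInv24_eq_denom_pow_mul ModularGroup.S ⟨τ, hτ⟩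
  rw [UpperHalfPlane.modular_S_smul, show ModularGroup.S 1 0 = 1 from rfl,
    show ModularGroup.S 1 1 = 0 from rfl, Int.cast_one, Int.cast_zero, one_mul, add_zero] at h
  rw [← inv_neg]
  exact h

lemma norm_exp_two_pi_I_div (τ : ℂ) :
    ‖Complex.exp (2 * π * I / τ)‖ = Real.exp (2 * π * (τ.im / Complex.normSq τ)) := by
  rw [Complex.norm_exp, div_eq_mul_inv, show 2 * π * I * τ⁻¹ = ((2 * π : ℝ) : ℂ) * (I * τ⁻¹) by
    push_cast; ring, Complex.re_ofReal_mul, Complex.I_mul_re, Complex.inv_im]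
  ring_nf

lemma exists_norm_etaInv24_le_of_coprime :
    ∃ C : ℝ, 0 < C ∧ ∀ x y : ℝ, 0 < y → ∃ c d : ℤ, IsCoprime c d ∧
      0 < (c * x + d) ^ 2 + (c * y) ^ 2 ∧ (c * x + d) ^ 2 + (c * y) ^ 2 ≤ 2 * y ∧
      ‖etaInv24 (x + y * I)‖ ≤ C * ((c * x + d) ^ 2 + (c * y) ^ 2) ^ 6 *
        Real.exp (2 * π * (y / ((c * x + d) ^ 2 + (c * y) ^ 2))) := by
  obtain ⟨C, hC, hb⟩ := exists_norm_etaInv24_le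
  refine ⟨C, hC, fun x y hy => ?_⟩
  have him : 0 < (x + y * I : ℂ).im := by simpa using hy
  obtain ⟨z, hz⟩ : ∃ z : UpperHalfPlane, (z : ℂ) = x + y * I := ⟨⟨_, him⟩, rfl⟩
  obtain ⟨g, hg⟩ := ModularGroup.exists_smul_mem_fd z
  have h3 := ModularGroup.three_le_four_mul_im_sq_of_mem_fd hg
  have hgpos := (g • z).im_pos
  -- In the fundamental domain Im ≥ √3/2; the weaker bound 1/2 suffices and yields D ≤ 2y.
  have hhalf : 1 / 2 ≤ (g • z).im := by nlinarith
  have hcop := ModularGroup.bottom_row_coprime g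
  have hdne := UpperHalfPlane.denom_ne_zero g z
  have hform := etaInv24_eq_denom_pow_mul g z
  have himf := ModularGroup.im_smul_eq_div_normSq g z
  have hden : UpperHalfPlane.denom g z =
      ((g 1 0 * x + g 1 1 : ℝ) : ℂ) + ((g 1 0 * y : ℝ) : ℂ) * I := by
    simp only [UpperHalfPlane.denom, hz]
    simp
    ring
  have hden' : ((g 1 0 : ℂ) * (x + y * I) + g 1 1) =
      ((g 1 0 * x + g 1 1 : ℝ) : ℂ) + ((g 1 0 * y : ℝ) : ℂ) * I := by
    push_cast
    ring
  rw [hden] at himf hdne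
  rw [Complex.normSq_add_mul_I] at himf
  have hDpos : 0 < (g 1 0 * x + g 1 1 : ℝ) ^ 2 + (g 1 0 * y : ℝ) ^ 2 := by
    rw [← Complex.normSq_add_mul_I]
    exact Complex.normSq_pos.mpr hdne
  have hy' : z.im = y := by
    rw [← UpperHalfPlane.coe_im, hz]
    simp
  rw [hy'] at himf
  refine ⟨g 1 0, g 1 1, hcop, hDpos, ?_, ?_⟩
  · rw [himf, le_div_iff₀ hDpos] at hhalf
    linarith
  · have hbd := hb (g • z : UpperHalfPlane) hhalf
    have himf' : ((g • z : UpperHalfPlane) : ℂ).im =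
      y / ((g 1 0 * x + g 1 1 : ℝ) ^ 2 + (g 1 0 * y : ℝ) ^ 2) := himf
    rw [himf'] at hbd
    rw [← hz, hform, hz, hden', norm_mul, norm_pow]
    have hn : ‖((g 1 0 * x + g 1 1 : ℝ) : ℂ) + ((g 1 0 * y : ℝ) : ℂ) * I‖ ^ 12 =
        ((g 1 0 * x + g 1 1 : ℝ) ^ 2 + (g 1 0 * y : ℝ) ^ 2) ^ 6 := by
      rw [show (12 : ℕ) = 2 * 6 by norm_num, pow_mul, ← Complex.normSq_eq_norm_sq,
        Complex.normSq_add_mul_I]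
    rw [hn, mul_comm C, mul_assoc]
    gcongr

/-- The size of `η⁻²⁴` at height `y` near the rational point `±1/2`. -/
noncomputable def halfPeak (x y : ℝ) : ℝ :=
  y ^ 12 * Real.exp (π / (2 * y)) *
    (Real.exp (-(π / (4 * y ^ 3)) * (x - 1 / 2) ^ 2) +
      Real.exp (-(π / (4 * y ^ 3)) * (x + 1 / 2) ^ 2))

lemma pow_mul_exp_le_of_lt {u y : ℝ} (hy : 0 < y)
    (hD : (2 * u) ^ 2 + (2 * y) ^ 2 < 8 * y ^ 2) :
    ((2 * u) ^ 2 + (2 * y) ^ 2) ^ 6 * Real.exp (2 * π * (y / ((2 * u) ^ 2 + (2 * y) ^ 2))) ≤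
      8 ^ 6 * (y ^ 12 * Real.exp (π / (2 * y)) * Real.exp (-(π / (4 * y ^ 3)) * u ^ 2)) := by
  have hu : u ^ 2 ≤ y ^ 2 := by nlinarith
  have hDpos : 0 < (2 * u) ^ 2 + (2 * y) ^ 2 := by positivity
  -- This is 1/(1 + t) ≤ 1 - t/2 on [0, 1] with t = u²/y²; it produces the Gaussian factor.
  have h1 : y / ((2 * u) ^ 2 + (2 * y) ^ 2) ≤ 1 / (4 * y) - u ^ 2 / (8 * y ^ 3) := by
    rw [div_le_iff₀ hDpos]
    have : (1 / (4 * y) - u ^ 2 / (8 * y ^ 3)) * ((2 * u) ^ 2 + (2 * y) ^ 2) =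
        y + u ^ 2 * (y ^ 2 - u ^ 2) / (2 * y ^ 3) := by
      field_simp
      ring
    rw [this]
    have : 0 ≤ u ^ 2 * (y ^ 2 - u ^ 2) / (2 * y ^ 3) := by
      have : 0 ≤ y ^ 2 - u ^ 2 := by linarith
      positivity
    linarith
  have h2 : Real.exp (2 * π * (y / ((2 * u) ^ 2 + (2 * y) ^ 2))) ≤
      Real.exp (π / (2 * y)) * Real.exp (-(π / (4 * y ^ 3)) * u ^ 2) := by
    rw [← Real.exp_add]
    apply Real.exp_le_exp.mpr
    calc 2 * π * (y / ((2 * u) ^ 2 + (2 * y) ^ 2)) ≤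
        2 * π * (1 / (4 * y) - u ^ 2 / (8 * y ^ 3)) := by gcongr
      _ = _ := by
        field_simp
        ring
  calc ((2 * u) ^ 2 + (2 * y) ^ 2) ^ 6 * Real.exp (2 * π * (y / ((2 * u) ^ 2 + (2 * y) ^ 2)))
      ≤ (8 * y ^ 2) ^ 6 *
        (Real.exp (π / (2 * y)) * Real.exp (-(π / (4 * y ^ 3)) * u ^ 2)) := by
        gcongr
    _ = _ := by ring

/-- With D = |cτ + d|², either D ≥ 8y² and the exponential is at most e^(π/(4y)), or |c| ≤ 2. For c
= 0 and c = ±1 the height y/D is at most 1/2, in the latter case because |τ + d| ≥ |τ| in the strip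
and `hτ` excludes the cusp 0. For c = ±2 coprimality and D < 1/2 leave d = ±1, the peaks at ±1/2. -/
lemma pow_mul_exp_le_of_coprime {x y : ℝ} (hx : |x| ≤ 1 / 2) (hy : 0 < y) (hy' : y ≤ 1 / 4)
    (hτ : y / (x ^ 2 + y ^ 2) < 1 / 2) {c d : ℤ} (hcd : IsCoprime c d)
    (hD0 : 0 < (c * x + d : ℝ) ^ 2 + (c * y) ^ 2)
    (hD : (c * x + d : ℝ) ^ 2 + (c * y) ^ 2 ≤ 2 * y) :
    ((c * x + d : ℝ) ^ 2 + (c * y) ^ 2) ^ 6 *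
        Real.exp (2 * π * (y / ((c * x + d : ℝ) ^ 2 + (c * y) ^ 2))) ≤
      Real.exp π + Real.exp (π / (4 * y)) + 8 ^ 6 * halfPeak x y := by
  obtain ⟨hx1, hx2⟩ := abs_le.mp hx
  have hpeak : 0 ≤ halfPeak x y := by
    unfold halfPeak
    positivity
  set D := (c * x + d : ℝ) ^ 2 + (c * y) ^ 2 with hDdef
  have hD1 : D ^ 6 ≤ 1 := pow_le_one₀ hD0.le (by linarith)
  have hlow (h : y / D ≤ 1 / 2) : D ^ 6 * Real.exp (2 * π * (y / D)) ≤
      Real.exp π + Real.exp (π / (4 * y)) + 8 ^ 6 * halfPeak x y := by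
    have h1 : D ^ 6 * Real.exp (2 * π * (y / D)) ≤ 1 * Real.exp (2 * π * (1 / 2)) := by gcongr
    rw [one_mul, show 2 * π * (1 / 2) = π by ring] at h1
    have := Real.exp_pos (π / (4 * y))
    linarith
  rcases le_or_gt (8 * y ^ 2) D with h8 | h8
  · have h1 : y / D ≤ 1 / (8 * y) := by
      rw [div_le_div_iff₀ hD0 (by positivity)]
      linarith
    have h2 : D ^ 6 * Real.exp (2 * π * (y / D)) ≤ 1 * Real.exp (2 * π * (1 / (8 * y))) := by gcongr
    rw [one_mul, show 2 * π * (1 / (8 * y)) = π / (4 * y) by field_simp; norm_num] at h2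
    have := Real.exp_pos π
    linarith
  · have hc8 : (c : ℝ) ^ 2 < 8 := by
      by_contra! h
      have : 8 * y ^ 2 ≤ (c : ℝ) ^ 2 * y ^ 2 := by gcongr
      nlinarith [sq_nonneg (c * x + d : ℝ)]
    have hc8' : c ^ 2 < 8 := by exact_mod_cast hc8
    have hcl : -2 ≤ c := by nlinarith
    have hcu : c ≤ 2 := by nlinarith
    wlog hc0 : 0 ≤ c generalizing c d
    · have e : (((-c : ℤ) : ℝ) * x + ((-d : ℤ) : ℝ)) ^ 2 + (((-c : ℤ) : ℝ) * y) ^ 2 = D := by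
        rw [hDdef]
        push_cast
        ring
      have := this (c := -c) (d := -d) (hcd.neg_neg) (by rwa [e]) (by rwa [e]) rfl
        (by rwa [e]) (by rwa [e]) (by rwa [e]) (by push_cast; nlinarith) (by nlinarith) (by omega)
        (by omega) (by omega)
      rwa [e] at this
    interval_cases c
    · apply hlow
      have hd : d ≠ 0 := by
        rintro rfl
        simp [hDdef] at hD0
      have hd1 : (1 : ℝ) ≤ (d : ℝ) ^ 2 := by
        have h1 : (1 : ℝ) ≤ |(d : ℝ)| := by exact_mod_cast Int.one_le_abs hd
        rw [← sq_abs]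
        nlinarith
      have : D = (d : ℝ) ^ 2 := by
        rw [hDdef]
        push_cast
        ring
      rw [div_le_iff₀ hD0]
      linarith
    · apply hlow
      have : x ^ 2 + y ^ 2 ≤ D := by
        rw [hDdef]
        push_cast
        have : x ^ 2 ≤ (1 * x + d) ^ 2 := by
          rcases lt_trichotomy d 0 with h | h | h
          · have : (d : ℝ) ≤ -1 := by exact_mod_cast (by omega : d ≤ -1)
            nlinarith
          · rw [h]
            simp
          · have : (1 : ℝ) ≤ d := by exact_mod_cast (by omega : 1 ≤ d)
            nlinarith
        linarith
      have h1 : y / D ≤ y / (x ^ 2 + y ^ 2) := by gcongr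
      linarith
    · have hodd : d ≠ 0 ∧ d ≠ 2 ∧ d ≠ -2 := by
        refine ⟨?_, ?_, ?_⟩ <;> rintro rfl <;> revert hcd <;> rw [Int.isCoprime_iff_gcd_eq_one] <;>
          decide
      have hDlt : D < 1 / 2 := by nlinarith
      have hsq : (2 * x + d) ^ 2 < 1 := by
        rw [hDdef] at hDlt
        push_cast at hDlt
        nlinarith [sq_nonneg (2 * y)]
      have habs := abs_lt.mp ((sq_lt_one_iff_abs_lt_one _).mp hsq)
      have hdl : -2 < d := by
        have : (-2 : ℝ) < d := by linarith
        exact_mod_cast this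
      have hdu : d < 2 := by
        have : (d : ℝ) < 2 := by linarith
        exact_mod_cast this
      have hexp := Real.exp_pos π
      have hexp' := Real.exp_pos (π / (4 * y))
      have hfac : 0 < y ^ 12 * Real.exp (π / (2 * y)) := by positivity
      rcases (by omega : d = 1 ∨ d = -1) with rfl | rfl
      · have e : D = (2 * (x + 1 / 2)) ^ 2 + (2 * y) ^ 2 := by
          rw [hDdef]
          push_cast
          ring
        have h := pow_mul_exp_le_of_lt hy (e ▸ h8)
        rw [← e] at h
        have h2 : y ^ 12 * Real.exp (π / (2 * y)) *
            Real.exp (-(π / (4 * y ^ 3)) * (x + 1 / 2) ^ 2) ≤ halfPeak x y := by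
          unfold halfPeak
          gcongr
          linarith [Real.exp_pos (-(π / (4 * y ^ 3)) * (x - 1 / 2) ^ 2)]
        linarith
      · have e : D = (2 * (x - 1 / 2)) ^ 2 + (2 * y) ^ 2 := by
          rw [hDdef]
          push_cast
          ring
        have h := pow_mul_exp_le_of_lt hy (e ▸ h8)
        rw [← e] at h
        have h2 : y ^ 12 * Real.exp (π / (2 * y)) *
            Real.exp (-(π / (4 * y ^ 3)) * (x - 1 / 2) ^ 2) ≤ halfPeak x y := by
          unfold halfPeak
          gcongr
          linarith [Real.exp_pos (-(π / (4 * y ^ 3)) * (x + 1 / 2) ^ 2)]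
        linarith

lemma exists_norm_etaInv24_sub_pow_mul_exp_le :
    ∃ C : ℝ, 0 < C ∧ ∀ x y : ℝ, |x| ≤ 1 / 2 → 0 < y → y ≤ 1 / 4 →
      ‖etaInv24 (x + y * I) - (x + y * I) ^ 12 * Complex.exp (2 * π * I / (x + y * I))‖ ≤
        C * (Real.exp (π / (4 * y)) + halfPeak x y) := by
  obtain ⟨C₁, hC₁, h₁⟩ := exists_norm_etaInv24_le_of_coprime
  obtain ⟨C₂, hC₂, h₂⟩ := exists_norm_etaInv24_sub_exp_le
  refine ⟨2 ^ 12 * C₂ + 2 ^ 12 * Real.exp π + C₁ * (Real.exp π + 1 + 8 ^ 6), by positivity,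
    fun x y hx hy hy' => ?_⟩
  have hre : (x + y * I : ℂ).re = x := by simp
  have him : (x + y * I : ℂ).im = y := by simp
  have hns : Complex.normSq (x + y * I) = x ^ 2 + y ^ 2 := Complex.normSq_add_mul_I x y
  have hnorm : ‖(x + y * I : ℂ)‖ ^ 12 ≤ 2 ^ 12 := by
    gcongr
    exact norm_le_two (by rwa [hre]) (by rwa [him]) (by rw [him]; linarith)
  have hpeak : 0 ≤ halfPeak x y := by
    unfold halfPeak
    positivity
  have hE : 1 ≤ Real.exp (π / (4 * y)) := Real.one_le_exp (by positivity)
  have hEpi := Real.exp_pos π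
  -- The quantity compared is Im(-1/τ). If it is at least 1/2, inversion gives the model term up to
  -- O(1); otherwise the model term is itself O(1) and only the size of η⁻²⁴ matters.
  rcases le_or_gt (1 / 2) (y / (x ^ 2 + y ^ 2)) with h | h
  · have h3 := h₂ (-(x + y * I : ℂ)⁻¹) (by
      rw [Complex.neg_im, Complex.inv_im, him, hns]
      rw [neg_div, neg_neg]
      exact h)
    have e : Complex.exp (-(2 * π * I * -(x + y * I : ℂ)⁻¹)) =
        Complex.exp (2 * π * I / (x + y * I)) := by
      congr 1
      ring
    rw [e] at h3
    rw [etaInv24_eq_pow_mul_neg_inv (by rwa [him]), ← mul_sub, norm_mul, norm_pow]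
    calc ‖(x + y * I : ℂ)‖ ^ 12 * _ ≤ 2 ^ 12 * C₂ := by gcongr
      _ ≤ (2 ^ 12 * C₂ + 2 ^ 12 * Real.exp π + C₁ * (Real.exp π + 1 + 8 ^ 6)) * 1 := by
        have h4 : 0 ≤ C₁ * (Real.exp π + 1 + 8 ^ 6) := by positivity
        linarith
      _ ≤ _ := by
        gcongr
        linarith
  · obtain ⟨c, d, hcd, hD0, hD, hbd⟩ := h₁ x y hy
    have h4 := pow_mul_exp_le_of_coprime hx hy hy' h hcd hD0 hD
    rw [mul_assoc] at hbd
    have h5 : ‖etaInv24 (x + y * I)‖ ≤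
        C₁ * (Real.exp π + Real.exp (π / (4 * y)) + 8 ^ 6 * halfPeak x y) :=
      hbd.trans (by gcongr)
    have h6 : ‖(x + y * I : ℂ) ^ 12 * Complex.exp (2 * π * I / (x + y * I))‖ ≤
        2 ^ 12 * Real.exp π := by
      rw [norm_mul, norm_pow, norm_exp_two_pi_I_div, him, hns]
      gcongr
      nlinarith [Real.pi_pos]
    refine (norm_sub_le _ _).trans ((add_le_add h5 h6).trans ?_)
    set E := Real.exp (π / (4 * y))
    set P := halfPeak x y
    set A := Real.exp π
    have t1 : 0 ≤ 2 ^ 12 * C₂ * (E + P) := by positivity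
    have t2 : 2 ^ 12 * A ≤ 2 ^ 12 * A * (E + P) := by
      exact le_mul_of_one_le_right (by positivity) (by linarith)
    have t3 : C₁ * (A + E + 8 ^ 6 * P) ≤ C₁ * (A + 1 + 8 ^ 6) * (E + P) := by
      rw [mul_assoc]
      apply mul_le_mul_of_nonneg_left _ hC₁.le
      have s1 : A ≤ A * (E + P) := le_mul_of_one_le_right hEpi.le (by linarith)
      have s2 : (A + 1 + 8 ^ 6) * (E + P) = A * (E + P) + (E + P) + 8 ^ 6 * (E + P) := by ring
      linarith
    have s3 : (2 ^ 12 * C₂ + 2 ^ 12 * A + C₁ * (A + 1 + 8 ^ 6)) * (E + P) =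
      2 ^ 12 * C₂ * (E + P) + 2 ^ 12 * A * (E + P) + C₁ * (A + 1 + 8 ^ 6) * (E + P) := by ring
    linarith

/-! ### Comparison of the coefficients of `η⁻²⁴` with their leading terms -/

lemma hasSum_etaInv24_sub_mainSeries {τ : ℂ} (hτ : 0 < τ.im) :
    HasSum (fun n : ℤ => (etaCoeff n - if 0 ≤ n then (mainCoeff n.toNat : ℂ) else 0) *
      Complex.exp (2 * π * I * n * τ)) (etaInv24 τ - mainSeries τ) := by
  have hinj : Function.Injective fun n : ℕ => (n : ℤ) := Nat.cast_injective
  have h : HasSum (fun n : ℤ => (if 0 ≤ n then (mainCoeff n.toNat : ℂ) else 0) *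
      Complex.exp (2 * π * I * n * τ)) (mainSeries τ) := by
    rw [← hinj.hasSum_iff]
    · refine (hasSum_mainSeries hτ).congr_fun fun n => ?_
      simp
    · intro n hn
      rw [if_neg, zero_mul]
      intro h
      exact hn ⟨n.toNat, by simp [h]⟩
  refine ((hasSum_etaInv24 hτ).sub h).congr_fun fun n => ?_
  ring

lemma integral_halfPeak_le {y : ℝ} (hy : 0 < y) :
    ∫ x in (-1 / 2 : ℝ)..(-1 / 2 + 1), halfPeak x y ≤
      y ^ 12 * Real.exp (π / (2 * y)) * (2 * √(4 * y ^ 3)) := by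
  have hb : 0 < π / (4 * y ^ 3) := by positivity
  have hg : MeasureTheory.Integrable fun u : ℝ => Real.exp (-(π / (4 * y ^ 3)) * u ^ 2) :=
    integrable_exp_neg_mul_sq hb
  have h1 (a : ℝ) : MeasureTheory.Integrable fun u : ℝ =>
      Real.exp (-(π / (4 * y ^ 3)) * (u + a) ^ 2) := hg.comp_add_right a
  have h2 (a : ℝ) : ∫ u : ℝ, Real.exp (-(π / (4 * y ^ 3)) * (u + a) ^ 2) = √(4 * y ^ 3) := by
    rw [MeasureTheory.integral_add_right_eq_self
      (fun u : ℝ => Real.exp (-(π / (4 * y ^ 3)) * u ^ 2)) a, integral_gaussian]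
    congr 1
    field_simp
  have hint : MeasureTheory.Integrable fun x : ℝ => halfPeak x y := by
    have := ((h1 (-(1 / 2))).add (h1 (1 / 2))).const_mul (y ^ 12 * Real.exp (π / (2 * y)))
    simpa only [halfPeak, sub_eq_add_neg, Pi.add_apply] using this
  have htot : ∫ x : ℝ, halfPeak x y = y ^ 12 * Real.exp (π / (2 * y)) * (2 * √(4 * y ^ 3)) := by
    simp only [halfPeak, sub_eq_add_neg]
    rw [MeasureTheory.integral_const_mul, MeasureTheory.integral_add (h1 _) (h1 _), h2, h2]
    ring
  rw [← htot, intervalIntegral.integral_of_le (by norm_num)]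
  refine MeasureTheory.setIntegral_le_integral hint (Eventually.of_forall fun x => ?_)
  simp only [Pi.zero_apply, halfPeak]
  positivity

lemma exists_norm_etaCoeff_sub_mainCoeff_le_of_height :
    ∃ C : ℝ, 0 < C ∧ ∀ m : ℕ, ∀ y : ℝ, 0 < y → y ≤ 1 / 4 →
      ‖etaCoeff m - mainCoeff m‖ ≤ C * Real.exp (2 * π * m * y) *
        (Real.exp (π / (4 * y)) + y ^ 12 * Real.exp (π / (2 * y)) * √(4 * y ^ 3)) := by
  obtain ⟨C₁, hC₁, h₁⟩ := exists_norm_etaInv24_sub_pow_mul_exp_le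
  obtain ⟨C₂, hC₂, h₂⟩ := exists_norm_mainSeries_sub_le
  refine ⟨2 * C₁ + C₂, by positivity, fun m y hy hy' => ?_⟩
  have hint := integral_mul_exp_of_hasSum (h := 1) (y := y) one_pos (-1 / 2)
    (c := fun n : ℤ => etaCoeff n - if 0 ≤ n then (mainCoeff n.toNat : ℂ) else 0)
    (F := fun x : ℝ => etaInv24 (x + y * I) - mainSeries (x + y * I)) (fun x => by
      have := hasSum_etaInv24_sub_mainSeries (τ := x + y * I) (by simpa using hy)
      simpa only [Complex.ofReal_one, div_one] using this) m
  simp only [Complex.ofReal_one, one_mul, Int.cast_natCast, Int.toNat_natCast,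
    Int.natCast_nonneg, if_true] at hint
  rw [← hint]
  have hE : 1 ≤ Real.exp (π / (4 * y)) := Real.one_le_exp (by positivity)
  have hpk (x : ℝ) : 0 ≤ halfPeak x y := by
    unfold halfPeak
    positivity
  have hcont : Continuous fun x => halfPeak x y := by
    unfold halfPeak
    fun_prop
  have hcont' : Continuous fun x => (C₁ * (Real.exp (π / (4 * y)) + halfPeak x y) + C₂) *
      Real.exp (2 * π * m * y) := by fun_prop
  have hle : (-1 / 2 : ℝ) ≤ -1 / 2 + 1 := by norm_num
  have hb := intervalIntegral.norm_integral_le_of_norm_le (μ := MeasureTheory.volume) hle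
    (f := fun x : ℝ => (etaInv24 (x + y * I) - mainSeries (x + y * I)) *
      Complex.exp (-(2 * π * I * m * (x + y * I) / 1)))
    (g := fun x => (C₁ * (Real.exp (π / (4 * y)) + halfPeak x y) + C₂) *
      Real.exp (2 * π * m * y))
    (Eventually.of_forall fun x hx => by
      have hx' : |x| ≤ 1 / 2 := abs_le.mpr ⟨by linarith [hx.1], by linarith [hx.2]⟩
      have e1 := h₁ x y hx' hy hy'
      have e2 := h₂ (x + y * I) (by simpa using hx') (by simpa using hy)
        (by simp; linarith)
      have e3 : ‖Complex.exp (-(2 * π * I * m * (x + y * I) / 1))‖ =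
          Real.exp (2 * π * m * y) := by
        have := norm_exp_two_pi_I (-m) 1 x y
        simpa using this
      rw [norm_mul, e3]
      gcongr
      calc ‖etaInv24 (x + y * I) - mainSeries (x + y * I)‖ =
          ‖(etaInv24 (x + y * I) - (x + y * I) ^ 12 * Complex.exp (2 * π * I / (x + y * I))) -
            (mainSeries (x + y * I) -
              (x + y * I) ^ 12 * Complex.exp (2 * π * I / (x + y * I)))‖ := by
            congr 1
            ring
        _ ≤ _ := (norm_sub_le _ _).trans (add_le_add e1 e2))
    (hcont'.intervalIntegrable _ _)
  refine hb.trans ?_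
  have hi1 : IntervalIntegrable (fun x => halfPeak x y) MeasureTheory.volume (-1 / 2)
    (-1 / 2 + 1) := hcont.intervalIntegrable _ _
  have hval : ∫ x in (-1 / 2 : ℝ)..(-1 / 2 + 1), (C₁ * (Real.exp (π / (4 * y)) + halfPeak x y) +
      C₂) * Real.exp (2 * π * m * y) = (C₁ * (Real.exp (π / (4 * y)) +
        ∫ x in (-1 / 2 : ℝ)..(-1 / 2 + 1), halfPeak x y) + C₂) * Real.exp (2 * π * m * y) := by
    rw [intervalIntegral.integral_mul_const, intervalIntegral.integral_add
      ((intervalIntegrable_const.add hi1).const_mul _) (by simp), intervalIntegral.integral_const_mul,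
      intervalIntegral.integral_add (by simp) hi1]
    simp
  rw [hval]
  have hpeak := integral_halfPeak_le hy
  set J := ∫ x in (-1 / 2 : ℝ)..(-1 / 2 + 1), halfPeak x y
  set E := Real.exp (π / (4 * y))
  set P := y ^ 12 * Real.exp (π / (2 * y))
  set R := √(4 * y ^ 3)
  have hP : 0 ≤ P * R := by positivity
  have key : C₁ * (E + J) + C₂ ≤ (2 * C₁ + C₂) * (E + P * R) := by
    have s1 : C₁ * (E + J) ≤ C₁ * (E + P * (2 * R)) := by gcongr
    have s2 : C₂ ≤ C₂ * (E + P * R) := le_mul_of_one_le_right hC₂.le (by linarith)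
    have s3 : 0 ≤ C₁ * E := by positivity
    linarith
  calc (C₁ * (E + J) + C₂) * Real.exp (2 * π * m * y) ≤
      ((2 * C₁ + C₂) * (E + P * R)) * Real.exp (2 * π * m * y) := by gcongr
    _ = _ := by ring

lemma rpow_eq_sqrt_pow {x : ℝ} (hx : 0 ≤ x) : x ^ (27 / 4 : ℝ) = √x ^ 13 * √(√x) := by
  rw [Real.sqrt_eq_rpow (√x), Real.sqrt_eq_rpow, ← Real.rpow_natCast, ← Real.rpow_mul hx,
    ← Real.rpow_mul hx, ← Real.rpow_add' hx (by norm_num)]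
  norm_num

lemma exists_norm_etaCoeff_sub_mainCoeff_le :
    ∃ C : ℝ, 0 < C ∧ ∀ m : ℕ, 4 ≤ m →
      ‖etaCoeff m - mainCoeff m‖ ≤ C * (Real.exp (2 * π * √m) / (m : ℝ) ^ (27 / 4 : ℝ)) := by
  obtain ⟨C, hC, h⟩ := exists_norm_etaCoeff_sub_mainCoeff_le_of_height
  refine ⟨C * (Nat.factorial 14 + 1), by positivity, fun m hm => ?_⟩
  have hm' : (4 : ℝ) ≤ m := by exact_mod_cast hm
  rw [rpow_eq_sqrt_pow (by linarith)]
  have hs2 : 2 ≤ √(m : ℝ) := Real.le_sqrt_of_sq_le (by linarith)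
  have hsq : √(m : ℝ) ^ 2 = m := Real.sq_sqrt (by linarith)
  set s := √(m : ℝ)
  have hs0 : 0 < s := by linarith
  have hy4 : 1 / (2 * s) ≤ 1 / 4 := by
    apply one_div_le_one_div_of_le <;> linarith
  -- The height 1/(2√m) minimises 2πmy + π/(2y), the exponent coming from the peaks at ±1/2; m ≥ 4
  -- keeps it at most 1/4.
  refine (h m (1 / (2 * s)) (by positivity) hy4).trans ?_
  have e1 : 2 * π * m * (1 / (2 * s)) = π * s := by
    rw [← hsq]
    field_simp
  have e2 : π / (4 * (1 / (2 * s))) = π * s / 2 := by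
    field_simp
    norm_num
  have e3 : π / (2 * (1 / (2 * s))) = π * s := by
    field_simp
  rw [e1, e2, e3]
  have hss : 0 < √s := Real.sqrt_pos.mpr hs0
  have hsss : √s ≤ s := by
    rw [Real.sqrt_le_left hs0.le]
    nlinarith
  have h4 : √(4 * (1 / (2 * s)) ^ 3) ≤ 1 / (s * √s) := by
    rw [Real.sqrt_le_left (by positivity), div_pow 1 (s * √s), mul_pow s, Real.sq_sqrt hs0.le,
      div_pow, mul_pow, one_pow, one_pow, mul_one_div, div_le_div_iff₀ (by positivity) (by positivity)]
    have : 0 ≤ s ^ 3 := by positivity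
    nlinarith
  have h12 : (1 / (2 * s)) ^ 12 ≤ 1 / s ^ 12 := by
    rw [div_pow, one_pow]
    gcongr
    linarith
  have hA : (1 / (2 * s)) ^ 12 * Real.exp (π * s) * √(4 * (1 / (2 * s)) ^ 3) ≤
      Real.exp (π * s) / (s ^ 13 * √s) := by
    calc (1 / (2 * s)) ^ 12 * Real.exp (π * s) * √(4 * (1 / (2 * s)) ^ 3) ≤
        1 / s ^ 12 * Real.exp (π * s) * (1 / (s * √s)) := by gcongr
      _ = _ := by
        field_simp
  -- The spare e^(πs/2) beats the power s^(27/2) ≤ s^14; hence 14!.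
  have hB : Real.exp (π * s / 2) ≤ Nat.factorial 14 * (Real.exp (π * s) / (s ^ 13 * √s)) := by
    have h14 := Real.pow_div_factorial_le_exp (x := π * s / 2) (by positivity) 14
    rw [div_le_iff₀ (by positivity)] at h14
    have hp : s ^ 13 * √s ≤ (π * s / 2) ^ 14 := by
      calc s ^ 13 * √s ≤ s ^ 13 * s := by gcongr
        _ = s ^ 14 := by ring
        _ ≤ _ := by
          gcongr
          nlinarith [Real.pi_gt_three]
    rw [← mul_div_assoc, le_div_iff₀ (by positivity),
      show Real.exp (π * s) = Real.exp (π * s / 2) * Real.exp (π * s / 2) by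
        rw [← Real.exp_add]; ring_nf]
    have := Real.exp_pos (π * s / 2)
    calc Real.exp (π * s / 2) * (s ^ 13 * √s) ≤
        Real.exp (π * s / 2) * (Real.exp (π * s / 2) * Nat.factorial 14) := by
          exact mul_le_mul_of_nonneg_left (hp.trans h14) this.le
      _ = _ := by ring
  calc C * Real.exp (π * s) * (Real.exp (π * s / 2) +
        (1 / (2 * s)) ^ 12 * Real.exp (π * s) * √(4 * (1 / (2 * s)) ^ 3))
      ≤ C * Real.exp (π * s) * (Nat.factorial 14 * (Real.exp (π * s) / (s ^ 13 * √s)) +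
          Real.exp (π * s) / (s ^ 13 * √s)) := by gcongr
    _ = C * (Nat.factorial 14 + 1) * (Real.exp (2 * π * s) / (s ^ 13 * √s)) := by
      rw [show 2 * π * s = π * s + π * s by ring, Real.exp_add]
      ring

/-! ### Asymptotics of the coefficients -/

/-- The Bessel form of the leading term, as a function of a real variable. -/
noncomputable def besselMain (p : ℕ) (z : ℝ) : ℝ :=
  2 * π * (p : ℝ) ^ (31 / 2 : ℝ) / z ^ (13 / 2 : ℝ) * besselI 13 (4 * π * √(p * z))

/-- The exponential form of the leading term, as a function of a real variable. -/
noncomputable def expMain (p : ℕ) (z : ℝ) : ℝ :=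
  (p : ℝ) ^ (61 / 4 : ℝ) * Real.exp (4 * π * √(p * z)) / (√2 * z ^ (27 / 4 : ℝ))

lemma expMain_pos {p : ℕ} (hp : 0 < p) {z : ℝ} (hz : 0 < z) : 0 < expMain p z := by
  have : (0 : ℝ) < p := by exact_mod_cast hp
  unfold expMain
  positivity

/-- With X = 4π√(pz) one has √(2πX) = 2π√2 (pz)^(1/4), which turns the exponents 31/2 and 13/2 into
61/4 and 27/4. -/
lemma besselMain_eq_expMain_mul {p : ℕ} (hp : 0 < p) {z : ℝ} (hz : 0 < z) :
    besselMain p z = expMain p z * (besselI 13 (4 * π * √(p * z)) *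
      (√(2 * π * (4 * π * √(p * z))) * Real.exp (-(4 * π * √(p * z))))) := by
  have hp' : (0 : ℝ) < p := by exact_mod_cast hp
  have h1 : √(2 * π * (4 * π * √(p * z))) = 2 * π * √2 * ((p : ℝ) ^ (1 / 4 : ℝ) *
      z ^ (1 / 4 : ℝ)) := by
    rw [show 2 * π * (4 * π * √(p * z)) = (2 * π) ^ 2 * (2 * √(p * z)) by ring,
      Real.sqrt_mul (by positivity), Real.sqrt_sq (by positivity),
      Real.sqrt_mul (by norm_num), Real.sqrt_eq_rpow √(p * z), Real.sqrt_eq_rpow (p * z),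
      ← Real.rpow_mul (by positivity), Real.mul_rpow hp'.le hz.le]
    norm_num
    ring
  have h2 : (p : ℝ) ^ (31 / 2 : ℝ) = (p : ℝ) ^ (61 / 4 : ℝ) * (p : ℝ) ^ (1 / 4 : ℝ) := by
    rw [← Real.rpow_add hp']
    norm_num
  have h3 : z ^ (27 / 4 : ℝ) = z ^ (13 / 2 : ℝ) * z ^ (1 / 4 : ℝ) := by
    rw [← Real.rpow_add hz]
    norm_num
  have hz1 : 0 < z ^ (13 / 2 : ℝ) := by positivity
  have hz2 : 0 < z ^ (1 / 4 : ℝ) := by positivity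
  rw [besselMain, expMain, h1, h2, h3, Real.exp_neg]
  field_simp

lemma tendsto_besselMain_div_expMain {p : ℕ} (hp : 0 < p) :
    Tendsto (fun z => besselMain p z / expMain p z) atTop (𝓝 1) := by
  have hp' : (0 : ℝ) < p := by exact_mod_cast hp
  have h1 : Tendsto (fun z : ℝ => 4 * π * √(p * z)) atTop atTop :=
    (Real.tendsto_sqrt_atTop.comp (tendsto_id.const_mul_atTop hp')).const_mul_atTop (by positivity)
  refine ((tendsto_besselI 13).comp h1).congr' ?_
  filter_upwards [eventually_gt_atTop 0] with z hz
  rw [besselMain_eq_expMain_mul hp hz, mul_div_cancel_left₀ _ (expMain_pos hp hz).ne']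
  rfl

lemma isEquivalent_besselMain_expMain {p : ℕ} (hp : 0 < p) :
    besselMain p ~[atTop] expMain p := by
  refine (isEquivalent_iff_tendsto_one ?_).mpr (tendsto_besselMain_div_expMain hp)
  filter_upwards [eventually_gt_atTop 0] with z hz
  exact (expMain_pos hp hz).ne'

lemma tendsto_sqrt_sub_sqrt (c : ℝ) : Tendsto (fun z : ℝ => √(z - c) - √z) atTop (𝓝 0) := by
  have hlim : Tendsto (fun z : ℝ => |c| / √z) atTop (𝓝 0) :=
    tendsto_const_nhds.div_atTop Real.tendsto_sqrt_atTop
  rw [tendsto_zero_iff_norm_tendsto_zero]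
  refine squeeze_zero' (Eventually.of_forall fun _ => norm_nonneg _) ?_ hlim
  filter_upwards [eventually_gt_atTop 0, eventually_ge_atTop c] with z hz hzc
  have h1 : 0 < √z := Real.sqrt_pos.mpr hz
  rw [le_div_iff₀ h1, Real.norm_eq_abs]
  have h2 : (√(z - c) - √z) * (√(z - c) + √z) = -c := by
    have s1 := Real.sq_sqrt (sub_nonneg.mpr hzc)
    have s2 := Real.sq_sqrt hz.le
    linear_combination s1 - s2
  calc |√(z - c) - √z| * √z ≤ |√(z - c) - √z| * |√(z - c) + √z| := by
        gcongr
        rw [abs_of_nonneg (by positivity)]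
        linarith [Real.sqrt_nonneg (z - c)]
    _ = |c| := by rw [← abs_mul, h2, abs_neg]

lemma isEquivalent_expMain_sub {p : ℕ} (hp : 0 < p) (c : ℝ) :
    (fun z => expMain p (z - c)) ~[atTop] expMain p := by
  have hp' : (0 : ℝ) < p := by exact_mod_cast hp
  have hne : ∀ᶠ z in atTop, expMain p z ≠ 0 := by
    filter_upwards [eventually_gt_atTop 0] with z hz
    exact (expMain_pos hp hz).ne'
  refine (isEquivalent_iff_tendsto_one hne).mpr ?_
  have h1 : Tendsto (fun z : ℝ => Real.exp (4 * π * (√(p * z - p * c) - √(p * z)))) atTop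
      (𝓝 1) := by
    have := ((tendsto_sqrt_sub_sqrt (p * c)).comp
      (tendsto_id.const_mul_atTop hp')).const_mul (4 * π)
    rw [mul_zero] at this
    simpa only [Real.exp_zero, Function.comp_def, id] using
      (Real.continuous_exp.tendsto _).comp this
  have h2 : Tendsto (fun z : ℝ => (z / (z - c)) ^ (27 / 4 : ℝ)) atTop (𝓝 1) := by
    have h3 : Tendsto (fun z : ℝ => 1 + c / (z - c)) atTop (𝓝 (1 + 0)) :=
      tendsto_const_nhds.add
        (tendsto_const_nhds.div_atTop (tendsto_atTop_add_const_right _ (-c) tendsto_id))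
    rw [add_zero] at h3
    have h4 : Tendsto (fun z : ℝ => z / (z - c)) atTop (𝓝 1) := by
      refine h3.congr' ?_
      filter_upwards [eventually_gt_atTop c] with z hz
      have : z - c ≠ 0 := (sub_pos.mpr hz).ne'
      field_simp
      ring
    have := h4.rpow_const (p := (27 / 4 : ℝ)) (Or.inl one_ne_zero)
    rwa [Real.one_rpow] at this
  have h := h1.mul h2
  rw [one_mul] at h
  refine h.congr' ?_
  filter_upwards [eventually_gt_atTop 0, eventually_gt_atTop c] with z hz hzc
  have hzc' : 0 < z - c := sub_pos.mpr hzc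
  have e1 : 0 < z ^ (27 / 4 : ℝ) := by positivity
  have e2 : 0 < (z - c) ^ (27 / 4 : ℝ) := by positivity
  have e3 : 0 < (p : ℝ) ^ (61 / 4 : ℝ) := by positivity
  simp only [Pi.div_apply, expMain]
  rw [mul_sub, Real.exp_sub, Real.div_rpow hz.le hzc'.le, mul_sub (p : ℝ)]
  field_simp

lemma isEquivalent_besselMain_sub {p : ℕ} (hp : 0 < p) (c : ℝ) :
    (fun z => besselMain p (z - c)) ~[atTop] expMain p :=
  ((isEquivalent_besselMain_expMain hp).comp_tendsto
    (tendsto_atTop_add_const_right _ (-c) tendsto_id)).trans (isEquivalent_expMain_sub hp c)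

lemma mainCoeff_eq_besselMain {m : ℕ} (hm : 0 < m) : mainCoeff m = besselMain 1 m := by
  rw [mainCoeff_eq_besselI hm, besselMain]
  simp

lemma pow_mul_mainCoeff_mul {p k : ℕ} (hp : 0 < p) (hk : 0 < k) :
    (p : ℝ) ^ 22 * mainCoeff (p * k) = besselMain p k := by
  have hp' : (0 : ℝ) < p := by exact_mod_cast hp
  have hk' : (0 : ℝ) < k := by exact_mod_cast hk
  rw [mainCoeff_eq_besselI (Nat.mul_pos hp hk), besselMain]
  push_cast
  rw [Real.mul_rpow hp'.le hk'.le]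
  have h : (p : ℝ) ^ 22 = (p : ℝ) ^ (31 / 2 : ℝ) * (p : ℝ) ^ (13 / 2 : ℝ) := by
    rw [← Real.rpow_add hp', ← Real.rpow_natCast]
    norm_num
  have h1 : 0 < (p : ℝ) ^ (13 / 2 : ℝ) := by positivity
  rw [h]
  field_simp

lemma exists_mainCoeff_bounds :
    ∃ M : ℕ, ∀ m : ℕ, M ≤ m → expMain 1 m ≤ 2 * mainCoeff m ∧ mainCoeff m ≤ 2 * expMain 1 m := by
  have h1 := (tendsto_besselMain_div_expMain one_pos).comp tendsto_natCast_atTop_atTop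
  have h2 := (h1.eventually_const_lt (by norm_num : (1 / 2 : ℝ) < 1)).and
    ((h1.eventually_lt_const (by norm_num : (1 : ℝ) < 2)).and (eventually_gt_atTop 0))
  obtain ⟨M, hM⟩ := eventually_atTop.mp h2
  refine ⟨M, fun m hm => ?_⟩
  obtain ⟨ha, hb, hc⟩ := hM m hm
  have hpos := expMain_pos one_pos (z := (m : ℝ)) (by exact_mod_cast hc)
  simp only [Function.comp] at ha hb
  rw [← mainCoeff_eq_besselMain hc] at ha hb
  rw [lt_div_iff₀ hpos] at ha
  rw [div_lt_iff₀ hpos] at hb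
  constructor <;> linarith

/-- Turns the absolute error into a relative one: e^(2π√m) m^(-27/4) is √2 e^(-2π√m) times the
exponential main term, which is within a factor 2 of `mainCoeff`. -/
lemma exists_norm_etaCoeff_bounds :
    ∃ (C : ℝ) (M : ℕ), 0 < C ∧ ∀ m : ℕ, M ≤ m → 0 < mainCoeff m ∧ expMain 1 m ≤ 2 * mainCoeff m ∧
      ‖etaCoeff m - mainCoeff m‖ ≤ C * Real.exp (-(2 * π * √m)) * mainCoeff m ∧
      ‖etaCoeff m‖ ≤ C * expMain 1 m := by
  obtain ⟨C, hC, h⟩ := exists_norm_etaCoeff_sub_mainCoeff_le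
  obtain ⟨M, hM⟩ := exists_mainCoeff_bounds
  refine ⟨4 * C + 2, max M 4, by positivity, fun m hm => ?_⟩
  obtain ⟨h1, h2⟩ := hM m (le_trans (le_max_left _ _) hm)
  have hm4 : 4 ≤ m := le_trans (le_max_right _ _) hm
  have hm0 : (0 : ℝ) < m := by exact_mod_cast (by omega : 0 < m)
  have hpos := expMain_pos one_pos hm0
  have hb : 0 < mainCoeff m := by linarith
  have h3 := h m hm4
  have hr : 0 < (m : ℝ) ^ (27 / 4 : ℝ) := by positivity
  have h2sqrt : √2 ≤ 2 := by
    rw [Real.sqrt_le_left (by norm_num)]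
    norm_num
  have e : Real.exp (2 * π * √m) / (m : ℝ) ^ (27 / 4 : ℝ) =
      √2 * (Real.exp (-(2 * π * √m)) * expMain 1 m) := by
    have e1 : Real.exp (4 * π * √m) = Real.exp (2 * π * √m) * Real.exp (2 * π * √m) := by
      rw [← Real.exp_add]
      ring_nf
    rw [expMain, Nat.cast_one, one_mul, Real.one_rpow, one_mul, e1, Real.exp_neg]
    field_simp
  have h4 : ‖etaCoeff m - mainCoeff m‖ ≤ 2 * C * (Real.exp (-(2 * π * √m)) * expMain 1 m) := by
    rw [e] at h3
    refine h3.trans ?_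
    have : 0 ≤ C * (Real.exp (-(2 * π * √m)) * expMain 1 m) := by positivity
    nlinarith
  have hexp : 0 < Real.exp (-(2 * π * √m)) := Real.exp_pos _
  have hexp1 : Real.exp (-(2 * π * √m)) ≤ 1 := by
    apply Real.exp_le_one_iff.mpr
    have : 0 ≤ 2 * π * √m := by positivity
    linarith
  refine ⟨hb, h1, ?_, ?_⟩
  · refine h4.trans ?_
    calc 2 * C * (Real.exp (-(2 * π * √m)) * expMain 1 m) ≤
        2 * C * (Real.exp (-(2 * π * √m)) * (2 * mainCoeff m)) := by gcongr
      _ = 4 * C * Real.exp (-(2 * π * √m)) * mainCoeff m := by ring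
      _ ≤ _ := by
        gcongr
        linarith
  · have h5 : ‖etaCoeff m‖ ≤ ‖etaCoeff m - mainCoeff m‖ + ‖(mainCoeff m : ℂ)‖ := by
      simpa using norm_add_le (etaCoeff m - mainCoeff m) (mainCoeff m : ℂ)
    rw [Complex.norm_real, Real.norm_of_nonneg hb.le] at h5
    have h6 : Real.exp (-(2 * π * √m)) * expMain 1 m ≤ expMain 1 m :=
      mul_le_of_le_one_left hpos.le hexp1
    have h7 : 2 * C * (Real.exp (-(2 * π * √m)) * expMain 1 m) ≤ 2 * C * expMain 1 m := by gcongr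
    have h8 : 0 ≤ C * expMain 1 m := by positivity
    linarith

/-- Controls a(n/p - 1) for n = p(j + 1). Since √(j + 1) ≤ √j + 1, the comparison of exponents
reduces to 2√j ≤ p√j, an equality when p = 2. -/
lemma expMain_one_le {p j : ℕ} (hp : 2 ≤ p) (hj : 0 < j) :
    expMain 1 j ≤ Real.exp (2 * π * p) * Real.exp (-(2 * π * √(p * (p * (j + 1) : ℝ)))) *
      ((p : ℝ) ^ 22 * expMain 1 (p * (p * j) : ℕ)) := by
  have hp' : (2 : ℝ) ≤ p := by exact_mod_cast hp
  have hp0 : (0 : ℝ) < p := by linarith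
  have hj' : (0 : ℝ) < j := by exact_mod_cast hj
  have e1 : √(p * (p * (j + 1) : ℝ)) = p * √(j + 1 : ℝ) := by
    rw [← mul_assoc, Real.sqrt_mul (by positivity), Real.sqrt_mul_self hp0.le]
  have e2 : √((p * (p * j) : ℕ) : ℝ) = p * √(j : ℝ) := by
    push_cast
    rw [← mul_assoc, Real.sqrt_mul (by positivity), Real.sqrt_mul_self hp0.le]
  have e3 : (((p * (p * j) : ℕ) : ℝ)) ^ (27 / 4 : ℝ) =
      (p : ℝ) ^ (27 / 2 : ℝ) * (j : ℝ) ^ (27 / 4 : ℝ) := by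
    push_cast
    rw [← mul_assoc, Real.mul_rpow (by positivity) hj'.le, Real.mul_rpow hp0.le hp0.le,
      ← Real.rpow_add hp0]
    norm_num
  have e4 : √(j + 1 : ℝ) ≤ √(j : ℝ) + 1 := by
    rw [Real.sqrt_le_left (by positivity)]
    have := Real.sq_sqrt hj'.le
    nlinarith [Real.sqrt_nonneg (j : ℝ)]
  have e5 : (p : ℝ) ^ (27 / 2 : ℝ) ≤ (p : ℝ) ^ 22 := by
    rw [← Real.rpow_natCast]
    exact Real.rpow_le_rpow_of_exponent_le (by linarith) (by norm_num)
  have hr : 0 < (j : ℝ) ^ (27 / 4 : ℝ) := by positivity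
  have hpr : 0 < (p : ℝ) ^ (27 / 2 : ℝ) := by positivity
  have e6 : Real.exp (4 * π * √(j : ℝ)) ≤ Real.exp (2 * π * p) *
      Real.exp (-(2 * π * (p * √(j + 1 : ℝ)))) * Real.exp (4 * π * (p * √(j : ℝ))) := by
    rw [← Real.exp_add, ← Real.exp_add]
    apply Real.exp_le_exp.mpr
    have t1 : 2 * √(j : ℝ) ≤ p * √(j : ℝ) := by gcongr
    have t2 : p * √(j + 1 : ℝ) ≤ p * (√(j : ℝ) + 1) := by gcongr
    have t3 : 2 * √(j : ℝ) ≤ p + -(p * √(j + 1 : ℝ)) + 2 * (p * √(j : ℝ)) := by linarith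
    have t4 := mul_le_mul_of_nonneg_left t3 Real.two_pi_pos.le
    linarith
  simp only [expMain, Nat.cast_one, one_mul, Real.one_rpow]
  rw [e1, e2, e3]
  set Q := Real.exp (2 * π * p) * Real.exp (-(2 * π * (p * √(j + 1 : ℝ))))
  have hQ : 0 < Q := by positivity
  calc Real.exp (4 * π * √(j : ℝ)) / (√2 * (j : ℝ) ^ (27 / 4 : ℝ)) ≤
      (Q * Real.exp (4 * π * (p * √(j : ℝ)))) / (√2 * (j : ℝ) ^ (27 / 4 : ℝ)) := by gcongr
    _ = (p : ℝ) ^ (27 / 2 : ℝ) * (Q * (Real.exp (4 * π * (p * √(j : ℝ))) /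
        (√2 * ((p : ℝ) ^ (27 / 2 : ℝ) * (j : ℝ) ^ (27 / 4 : ℝ))))) := by field_simp
    _ ≤ (p : ℝ) ^ 22 * (Q * (Real.exp (4 * π * (p * √(j : ℝ))) /
        (√2 * ((p : ℝ) ^ (27 / 2 : ℝ) * (j : ℝ) ^ (27 / 4 : ℝ))))) := by gcongr
    _ = _ := by ring

lemma exists_norm_supersingularCoeff_sub_le {p : ℕ} (hp : 2 ≤ p) :
    ∃ (C : ℝ) (N : ℕ), ∀ n : ℕ, N ≤ n → 0 < besselMain p (n - p) ∧
      ‖supersingularCoeff p n - besselMain p (n - p)‖ ≤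
        C * Real.exp (-(2 * π * √(p * n))) * besselMain p (n - p) := by
  obtain ⟨C, M, hC, h⟩ := exists_norm_etaCoeff_bounds
  have hp0 : 0 < p := by omega
  have hp' : (2 : ℝ) ≤ p := by exact_mod_cast hp
  -- The factor e^(2πp) pays for replacing √(p(n - p)) by √(pn) in the exponent. The threshold makes
  -- both p(n - p) and n/p - 1 large enough for the bounds on a.
  refine ⟨C * Real.exp (2 * π * p) + 2 * (C * Real.exp (2 * π * p)), p * (M + 2), fun n hn => ?_⟩
  obtain ⟨k, rfl⟩ : ∃ k, n = k + p := ⟨n - p, by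
    have : p ≤ p * (M + 2) := Nat.le_mul_of_pos_right _ (by omega)
    omega⟩
  have hkM : p * (M + 1) ≤ k := by
    have : p * (M + 2) = p * (M + 1) + p := by ring
    omega
  have hkM' : M + 1 ≤ k := (Nat.le_mul_of_pos_left _ hp0).trans hkM
  have hk0 : 0 < k := by omega
  have ek : ((k + p : ℕ) : ℝ) - p = k := by
    push_cast
    ring
  have hkm : k ≤ p * k := Nat.le_mul_of_pos_left _ hp0
  obtain ⟨hb, hlow, hdiff, -⟩ := h (p * k) (by omega)
  have hmain := pow_mul_mainCoeff_mul hp0 hk0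
  have hB : 0 < besselMain p k := by
    rw [← hmain]
    positivity
  rw [ek]
  refine ⟨hB, ?_⟩
  have hfirst : ‖(p : ℂ) ^ 22 * (etaCoeff (p * k : ℕ) - mainCoeff (p * k))‖ ≤
      C * Real.exp (2 * π * p) * Real.exp (-(2 * π * √(p * (k + p : ℕ)))) * besselMain p k := by
    have hs : √(p * (k + p : ℕ) : ℝ) ≤ √((p * k : ℕ) : ℝ) + p := by
      rw [Real.sqrt_le_left (by positivity)]
      have := Real.sq_sqrt (Nat.cast_nonneg (α := ℝ) (p * k))
      push_cast at this ⊢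
      nlinarith [Real.sqrt_nonneg (p * k : ℝ)]
    have he : Real.exp (-(2 * π * √((p * k : ℕ) : ℝ))) ≤
        Real.exp (2 * π * p) * Real.exp (-(2 * π * √(p * (k + p : ℕ) : ℝ))) := by
      rw [← Real.exp_add]
      apply Real.exp_le_exp.mpr
      have := mul_le_mul_of_nonneg_left hs Real.two_pi_pos.le
      linarith
    rw [norm_mul, norm_pow, Complex.norm_natCast]
    calc (p : ℝ) ^ 22 * ‖etaCoeff (p * k : ℕ) - mainCoeff (p * k)‖ ≤
        (p : ℝ) ^ 22 * (C * (Real.exp (2 * π * p) *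
          Real.exp (-(2 * π * √(p * (k + p : ℕ) : ℝ)))) * mainCoeff (p * k)) := by
          gcongr
          exact hdiff.trans (by gcongr)
      _ = _ := by
        rw [← hmain]
        ring
  have hsecond : ‖(if (p : ℤ) ∣ ((k + p : ℕ) : ℤ) then
      1 / (p : ℂ) ^ 2 * etaCoeff (((k + p : ℕ) : ℤ) / p - 1) else 0)‖ ≤
      2 * (C * Real.exp (2 * π * p)) * Real.exp (-(2 * π * √(p * (k + p : ℕ)))) *
        besselMain p k := by
    split_ifs with hdvd
    · obtain ⟨j, rfl⟩ : p ∣ k := by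
        rw [Int.natCast_dvd_natCast] at hdvd
        exact (Nat.dvd_add_left (dvd_refl p)).mp hdvd
      have hj : M + 1 ≤ j := Nat.le_of_mul_le_mul_left hkM hp0
      have ej : ((p * j + p : ℕ) : ℤ) / p - 1 = (j : ℤ) := by
        rw [show ((p * j + p : ℕ) : ℤ) = p * ((j : ℤ) + 1) by push_cast; ring,
          Int.mul_ediv_cancel_left _ (by omega)]
        ring
      obtain ⟨-, -, -, hj4⟩ := h j (by omega)
      have h5 := expMain_one_le hp (j := j) (by omega)
      rw [ej, norm_mul]
      have h6 : ‖1 / (p : ℂ) ^ 2‖ ≤ 1 := by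
        rw [norm_div, norm_one, norm_pow, Complex.norm_natCast]
        apply div_le_one_of_le₀ _ (by positivity)
        nlinarith
      have ep : ((p * j + p : ℕ) : ℝ) = p * (j + 1) := by
        push_cast
        ring
      rw [ep]
      set X := Real.exp (-(2 * π * √(p * (p * (j + 1) : ℝ))))
      calc ‖1 / (p : ℂ) ^ 2‖ * ‖etaCoeff j‖ ≤ 1 * (C * expMain 1 j) := by gcongr
        _ ≤ 1 * (C * (Real.exp (2 * π * p) * X *
            ((p : ℝ) ^ 22 * expMain 1 (p * (p * j) : ℕ)))) := by gcongr
        _ ≤ 1 * (C * (Real.exp (2 * π * p) * X *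
            ((p : ℝ) ^ 22 * (2 * mainCoeff (p * (p * j)))))) := by gcongr
        _ = _ := by
          rw [← hmain]
          ring
    · rw [norm_zero]
      positivity
  have esplit : supersingularCoeff p (k + p : ℕ) - besselMain p k =
      (p : ℂ) ^ 22 * (etaCoeff (p * k : ℕ) - mainCoeff (p * k)) +
      (if (p : ℤ) ∣ ((k + p : ℕ) : ℤ) then
        1 / (p : ℂ) ^ 2 * etaCoeff (((k + p : ℕ) : ℤ) / p - 1) else 0) := by
    rw [supersingularCoeff, ← hmain, show (p : ℤ) * (((k + p : ℕ) : ℤ) - p) = ((p * k : ℕ) : ℤ) by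
      push_cast; ring]
    push_cast
    ring
  rw [esplit]
  refine (norm_add_le _ _).trans ((add_le_add hfirst hsecond).trans (le_of_eq ?_))
  ring

/-! ### Real values and passage to asymptotic equivalence. -/

lemma exists_ofReal_eq_supersingularCoeff (p : ℕ) (n : ℤ) :
    ∃ r : ℝ, supersingularCoeff p n = r := by
  refine ⟨(p : ℝ) ^ 22 * (etaCoeff (p * (n - p))).re +
    if (p : ℤ) ∣ n then 1 / (p : ℝ) ^ 2 * (etaCoeff (n / p - 1)).re else 0, ?_⟩
  rw [supersingularCoeff, etaCoeff_eq_re (p * (n - p)), etaCoeff_eq_re (n / p - 1)]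
  push_cast
  split_ifs <;> simp

lemma isEquivalent_ofReal {f g : ℕ → ℝ} (h : f ~[atTop] g) :
    (fun n => (f n : ℂ)) ~[atTop] fun n => (g n : ℂ) := by
  have h1 : (fun n => ((f n - g n : ℝ) : ℂ)) =o[atTop] fun n => (g n : ℂ) := by
    rw [← isLittleO_norm_norm]
    simp only [Complex.norm_real]
    exact isLittleO_norm_norm.mpr h
  simpa [IsEquivalent, Pi.sub_def] using h1

lemma isEquivalent_of_norm_sub_le {f : ℕ → ℂ} {g ε : ℕ → ℝ}
    (hε : Tendsto ε atTop (𝓝 0)) (h : ∀ᶠ n in atTop, ‖f n - g n‖ ≤ ε n * g n) :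
    f ~[atTop] fun n => (g n : ℂ) := by
  have h1 : (fun n => f n - (g n : ℂ)) =O[atTop] fun n => ε n * g n := by
    refine IsBigO.of_bound 1 ?_
    filter_upwards [h] with n hn
    rw [one_mul]
    exact hn.trans (le_abs_self _)
  have h2 : (fun n => ε n * g n) =o[atTop] fun n => (g n : ℂ) := by
    rw [← isLittleO_norm_right]
    simp only [Complex.norm_real]
    rw [isLittleO_norm_right]
    simpa using ((isLittleO_one_iff ℝ).mpr hε).mul_isBigO (isBigO_refl g atTop)
  exact h1.trans_isLittleO h2

lemma isEquivalent_supersingularCoeff {p : ℕ} (hp : 2 ≤ p) :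
    (fun n : ℕ => supersingularCoeff p n) ~[atTop] fun n : ℕ => (expMain p n : ℂ) := by
  obtain ⟨C, N, h⟩ := exists_norm_supersingularCoeff_sub_le hp
  have hp0 : 0 < p := by omega
  have hp' : (0 : ℝ) < p := by exact_mod_cast hp0
  have hε : Tendsto (fun n : ℕ => C * Real.exp (-(2 * π * √(p * n)))) atTop (𝓝 0) := by
    have h1 : Tendsto (fun n : ℕ => 2 * π * √(p * n)) atTop atTop :=
      (Real.tendsto_sqrt_atTop.comp
        (tendsto_natCast_atTop_atTop.const_mul_atTop hp')).const_mul_atTop Real.two_pi_pos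
    simpa using (Real.tendsto_exp_neg_atTop_nhds_zero.comp h1).const_mul C
  refine (isEquivalent_of_norm_sub_le hε (g := fun n => besselMain p (n - p)) ?_).trans
    (isEquivalent_ofReal
      ((isEquivalent_besselMain_sub hp0 p).comp_tendsto tendsto_natCast_atTop_atTop))
  filter_upwards [eventually_ge_atTop N] with n hn
  exact (h n hn).2

end VafaWitten

theorem corollary3p2 (p : ℕ) (hp : p.Prime) :
    ∃ (C : ℝ) (N : ℕ), ∀ (k : Type u) [Field k] [IsAlgClosed k] (S : AlgebraicGeometry.Scheme.{u})
      (f : S ⟶ AlgebraicGeometry.Spec (CommRingCat.of k)),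
      IsK3Surface f → picardNumber S = 22 →
        -- all non-integral powers of `q` vanish
        (∀ n : ℤ, ¬ (p : ℤ) ∣ n → alpha3 S p n = 0) ∧
        (∀ τ : ℂ, 0 < τ.im →
          HasSum (fun n : ℕ => alpha3' S p n * Complex.exp (2 * Real.pi * Complex.I * n * τ))
            (twistedPartitionFunction S p τ)) ∧
        -- exact formula
        (∀ n : ℤ, alpha3' S p n =
          (p : ℂ) ^ 22 * etaCoeff (p * (n - p)) +
            if (p : ℤ) ∣ n then 1 / (p : ℂ) ^ 2 * etaCoeff (n / p - 1) else 0) ∧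
        -- asymptotics with a rate, whose constants depend only on `p`
        (∀ n : ℕ, N ≤ n → ∃ E : ℝ,
          |E| ≤ C * Real.exp (-(2 * Real.pi * √(p * n))) ∧
          alpha3' S p n =
            ((2 * Real.pi * (p : ℝ) ^ (31 / 2 : ℝ) / ((n : ℝ) - p) ^ (13 / 2 : ℝ) *
              besselI 13 (4 * Real.pi * √(p * ((n : ℝ) - p))) * (1 + E) : ℝ) : ℂ)) ∧
        ((fun n : ℕ => alpha3' S p n) ~[atTop] fun n : ℕ =>
          ((2 * Real.pi * (p : ℝ) ^ (31 / 2 : ℝ) / (n : ℝ) ^ (13 / 2 : ℝ) *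
            besselI 13 (4 * Real.pi * √(p * n)) : ℝ) : ℂ)) ∧
        ((fun n : ℕ => alpha3' S p n) ~[atTop] fun n : ℕ =>
          (((p : ℝ) ^ (61 / 4 : ℝ) * Real.exp (4 * Real.pi * √(p * n)) /
            (√2 * (n : ℝ) ^ (27 / 4 : ℝ)) : ℝ) : ℂ)) := by
  have hp2 := hp.two_le
  have hp0 := hp.pos
  obtain ⟨C, N, h⟩ := exists_norm_supersingularCoeff_sub_le hp2
  -- C and N come from a bound on `supersingularCoeff`, which involves p alone, so they can be fixed
  -- before the field and the surface.
  refine ⟨C, N, fun k _ _ S f _ hS => ⟨fun n hn => alpha3_eq_zero hS hp0 hn,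
    fun τ hτ => hasSum_alpha3' hS hp2 hτ, fun n => alpha3'_eq hS hp0 n, fun n hn => ?_, ?_, ?_⟩⟩
  · obtain ⟨hpos, hle⟩ := h n hn
    obtain ⟨r, hr⟩ := exists_ofReal_eq_supersingularCoeff p n
    refine ⟨r / besselMain p (n - p) - 1, ?_, ?_⟩
    · rw [hr, ← Complex.ofReal_sub, Complex.norm_real, Real.norm_eq_abs] at hle
      rw [div_sub_one hpos.ne', abs_div, abs_of_pos hpos, div_le_iff₀ hpos]
      exact hle
    · rw [alpha3'_eq hS hp0, hr, Complex.ofReal_inj]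
      change r = besselMain p (n - p) * (1 + (r / besselMain p (n - p) - 1))
      field_simp
      ring
  · simp only [alpha3'_eq hS hp0]
    exact (isEquivalent_supersingularCoeff hp2).trans (isEquivalent_ofReal
      ((isEquivalent_besselMain_expMain hp0).comp_tendsto tendsto_natCast_atTop_atTop)).symm
  · simp only [alpha3'_eq hS hp0]
    exact isEquivalent_supersingularCoeff hp2
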